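/- Let $R$ be a commutative noetherian ring and let $\mathfrak a$ be an ideal of $R$ contained in the Jacobson radical $J(R)$. Let $M$ be an $R$-complex, viewed in the derived category $\mathrm D(R)$; write $M\simeq 0$ if $\mathrm H_n(M)=0$ for all $n$, and set $\sup M=\sup\{n : \mathrm H_n(M)\ne 0\}$ and $\inf M=\inf\{n : \mathrm H_n(M)\neq 0\}$ (with $\sup\emptyset=-\infty$, $\inf\emptyset=+\infty$). 1. Suppose that $M$ is bounded above, i.e. $\mathrm H_n(M)=0$ for all $n\gg 0$. If $\mathrm{Ass}_RM\cap\mathrm{Max}\,R\neq\emptyset$, then $\mathrm{RHom}_R(R/\mathfrak a,M)\not\simeq 0$. 2. Suppose that $M$ is bounded below, i.e. $\mathrm H_n(M)=0$ for all $n\ll 0$. If $\mathrm{Coass}_RM\cap\mathrm{Max}\,R\neq\emptyset$, then $R/\mathfrak a\otimes^{\mathrm L}_RM\not\simeq 0$. Here $\mathrm{Max}\,R$ is the set of maximal ideals of $R$, $E_A(K)$ denotes the injective hull of an $A$-module $K$, and $k(\mathfrak p)=R_{\mathfrak p}/\mathfrak pR_{\mathfrak p}$. For a complex $N$ over a local ring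 $(A,\mathfrak n,k)$, $\mathrm{depth}_AN=-\sup\mathrm{RHom}_A(k,N)$ and $\mathrm{width}_AN=\inf(k\otimes^{\mathrm L}_AN)$. For $M$ bounded above, $$\mathrm{Ass}_RM=\{\mathfrak p\in\mathrm{Spec}\,R : \mathrm{depth}_{R_{\mathfrak p}}M_{\mathfrak p}=-\sup M_{\mathfrak p}<\infty\}.$$ Put $D_R(M)=\mathrm{Hom}_R\bigl(M,\bigoplus_{\mathfrak m\in\mathrm{Max}\,R}E_R(R/\mathfrak m)\bigr)$ and let ${}^{\mathfrak p}M=\mathrm{Hom}_{R_{\mathfrak p}}\bigl(D_R(M)_{\mathfrak p},E_{R_{\mathfrak p}}(k(\mathfrak p))\bigr)$ be the co-localization of $M$ at $\mathfrak p$. For $M$ bounded below, $$\mathrm{Coass}_RM=\{\mathfrak p\in\mathrm{Spec}\,R : {}^{\mathfrak p}M\not\simeq 0\ \text{and}\ \mathrm{width}_{R_{\mathfrak p}}{}^{\mathfrak p}M=\inf{}^{\mathfrak p}M\}.$$ -/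

import Mathlib

open CategoryTheory DirectSum

universe u

/-! Complexes are `ℤ`-indexed cochain complexes of `R`-modules, and every object of the derived
category `D(R)` is represented by one. Homological degree `n` is cohomological degree `-n`. -/

namespace DerivedAssoc

section InjectiveHull

/-- `ι : K → E` is an injective hull: `E` is injective and `ι` is an essential monomorphism. -/
structure IsInjectiveHull (R : Type u) [CommRing R] {K E : Type u} [AddCommGroup K] [Module R K]
    [AddCommGroup E] [Module R E] (ι : K →ₗ[R] E) : Prop where
  injective_module : Module.Injective R E
  injective_map : Function.Injective ι
  essential : ∀ N : Submodule R E, N ⊓ LinearMap.range ι = ⊥ → N = ⊥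

theorem exists_isInjectiveHull (R : Type u) [CommRing R] (K : Type u) [AddCommGroup K]
    [Module R K] : ∃ (E : ModuleCat.{u} R) (ι : K →ₗ[R] E), IsInjectiveHull R ι := by
  let P := Classical.choice (EnoughInjectives.presentation (ModuleCat.of R K))
  let I : ModuleCat.{u} R := P.J
  have hI : Injective I := P.injective
  let f : ModuleCat.of R K ⟶ I := P.f
  have hf : Mono f := P.mono
  have hIinj : Module.Injective R I := Module.injective_module_of_injective_object R I
  have hfi : Function.Injective f.hom := (ModuleCat.mono_iff_injective f).1 hf
  let A : Submodule R I := LinearMap.range f.hom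
  -- a maximal essential extension of the image of `K` inside `I`
  let S : Set (Submodule R I) :=
    {B | A ≤ B ∧ ∀ N : Submodule R I, N ≤ B → N ⊓ A = ⊥ → N = ⊥}
  have hAS : A ∈ S := ⟨le_rfl, fun N hN h => by rwa [inf_eq_left.2 hN] at h⟩
  obtain ⟨B, hAB, hB⟩ := zorn_le_nonempty₀ S (by
    intro c hc hchain y hy
    refine ⟨sSup c, ⟨(hc hy).1.trans (le_sSup hy), ?_⟩, fun z hz => le_sSup hz⟩
    intro N hN h
    rw [Submodule.eq_bot_iff]
    intro x hx
    obtain ⟨z, hz, hxz⟩ := (Submodule.mem_sSup_of_directed ⟨y, hy⟩ hchain.directedOn).1 (hN hx)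
    have h1 : Submodule.span R {x} = ⊥ := by
      apply (hc hz).2
      · simpa [Submodule.span_le] using hxz
      · rw [eq_bot_iff, ← h]
        exact inf_le_inf_right _ (by simpa [Submodule.span_le] using hx)
    simpa using h1) A hAS
  -- a complement `C`, maximal among the submodules that meet `B` trivially
  obtain ⟨C, -, hC⟩ := zorn_le_nonempty₀ {C : Submodule R I | C ⊓ B = ⊥} (by
    intro c hc hchain y hy
    refine ⟨sSup c, ?_, fun z hz => le_sSup hz⟩
    change sSup c ⊓ B = ⊥
    rw [Submodule.eq_bot_iff]
    rintro x ⟨hx, hxB⟩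
    obtain ⟨z, hz, hxz⟩ := (Submodule.mem_sSup_of_directed ⟨y, hy⟩ hchain.directedOn).1 hx
    have : x ∈ z ⊓ B := ⟨hxz, hxB⟩
    rw [hc hz] at this
    simpa using this) ⊥ (bot_inf_eq B)
  have hCB : C ⊓ B = ⊥ := hC.prop
  let g : B →ₗ[R] (I ⧸ C) := C.mkQ.comp B.subtype
  have hg : Function.Injective g := by
    rw [← LinearMap.ker_eq_bot, Submodule.eq_bot_iff]
    intro x hx
    have hxC : (x : I) ∈ C := by simpa [g] using hx
    have : (x : I) ∈ C ⊓ B := ⟨hxC, x.2⟩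
    rw [hCB] at this
    ext
    simpa using this
  obtain ⟨h, hh⟩ := hIinj.out g hg B.subtype
  -- `h` is injective
  have hker : ∀ N : Submodule R (I ⧸ C), N ⊓ LinearMap.range g = ⊥ → N = ⊥ := by
    intro N hN
    have hle : C ≤ N.comap C.mkQ := by
      intro x hx
      simp [(Submodule.Quotient.mk_eq_zero C).2 hx]
    have h2 : N.comap C.mkQ ⊓ B = ⊥ := by
      rw [Submodule.eq_bot_iff]
      rintro x ⟨hx, hxB⟩
      have h3 : g ⟨x, hxB⟩ ∈ N ⊓ LinearMap.range g := ⟨hx, ⟨_, rfl⟩⟩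
      rw [hN, Submodule.mem_bot] at h3
      have := hg (h3.trans (map_zero g).symm)
      simpa using congrArg Subtype.val this
    have h4 : N.comap C.mkQ ≤ C := hC.le_of_ge h2 hle
    rw [Submodule.eq_bot_iff]
    intro x hx
    obtain ⟨y, rfl⟩ := C.mkQ_surjective x
    exact (Submodule.Quotient.mk_eq_zero C).2 (h4 hx)
  have hhi : Function.Injective h := by
    rw [← LinearMap.ker_eq_bot]
    apply hker
    rw [Submodule.eq_bot_iff]
    rintro _ ⟨hx, ⟨y, rfl⟩⟩
    have : (y : I) = 0 := by
      have h5 := hh y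
      rw [LinearMap.mem_ker.1 hx] at h5
      exact h5.symm
    have : y = 0 := Subtype.ext this
    simp [this]
  -- the range of `h` is an essential extension of the image of `K`, so it is `B`
  have hBr : B ≤ LinearMap.range h := by
    intro x hx
    exact ⟨g ⟨x, hx⟩, hh ⟨x, hx⟩⟩
  have hrS : LinearMap.range h ∈ S := by
    refine ⟨hB.prop.1.trans hBr, fun N hN hNA => ?_⟩
    have h6 : N ⊓ B = ⊥ :=
      hB.prop.2 _ inf_le_right (by rw [inf_assoc, inf_eq_right.2 hB.prop.1, hNA])
    have h7 : N.comap h = ⊥ := by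
      apply hker
      rw [Submodule.eq_bot_iff]
      rintro _ ⟨hx, ⟨y, rfl⟩⟩
      have h8 : (y : I) ∈ N ⊓ B := by
        refine ⟨?_, y.2⟩
        have h5 := hh y
        have h9 : h (g y) ∈ N := hx
        rw [h5] at h9
        exact h9
      rw [h6, Submodule.mem_bot] at h8
      have : y = 0 := Subtype.ext h8
      simp [this]
    rw [Submodule.eq_bot_iff]
    intro x hx
    obtain ⟨y, rfl⟩ := hN hx
    have : y ∈ N.comap h := hx
    rw [h7, Submodule.mem_bot] at this
    simp [this]
  have hrB : LinearMap.range h ≤ B := hB.le_of_ge hrS hBr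
  -- hence `B` is a retract of `I`
  let r : I →ₗ[R] B := (h.comp C.mkQ).codRestrict B (fun x => hrB ⟨_, rfl⟩)
  have hr : ∀ x : B, r x = x := by
    intro x
    ext
    exact hh x
  refine ⟨ModuleCat.of R B, f.hom.codRestrict B (fun x => hB.prop.1 ⟨x, rfl⟩), ⟨⟨?_⟩, ?_, ?_⟩⟩
  · intro X Y _ _ _ _ i hi φ
    obtain ⟨ψ, hψ⟩ := hIinj.out i hi (B.subtype.comp φ)
    refine ⟨r.comp ψ, fun x => ?_⟩
    have h10 : r (ψ (i x)) = r ((B.subtype.comp φ) x) := by rw [hψ x]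
    exact h10.trans (hr (φ x))
  · intro x y hxy
    exact hfi (congrArg Subtype.val hxy)
  · intro N hN
    have h11 : N.map B.subtype = ⊥ := by
      apply hB.prop.2 _ (Submodule.map_subtype_le B N)
      rw [Submodule.eq_bot_iff]
      rintro _ ⟨⟨y, hy, rfl⟩, ⟨z, hz⟩⟩
      have h12 : y ∈ N ⊓ LinearMap.range
          (f.hom.codRestrict B (fun x => hB.prop.1 ⟨x, rfl⟩)) :=
        ⟨hy, ⟨z, Subtype.ext hz⟩⟩
      rw [hN, Submodule.mem_bot] at h12
      simp [h12]
    exact Submodule.map_injective_of_injective B.injective_subtype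
      (h11.trans (Submodule.map_bot B.subtype).symm)

/-- The injective hull `E_R(K)`. -/
noncomputable def injectiveHull (R : Type u) [CommRing R] (K : Type u) [AddCommGroup K]
    [Module R K] : ModuleCat.{u} R :=
  (exists_isInjectiveHull R K).choose

theorem injectiveHull_spec (R : Type u) [CommRing R] (K : Type u) [AddCommGroup K]
    [Module R K] : ∃ ι : K →ₗ[R] injectiveHull R K, IsInjectiveHull R ι :=
  (exists_isInjectiveHull R K).choose_spec

end InjectiveHull

section Complexes

variable {R : Type u} [CommRing R]

/-- The homology module `H_n(M)` in homological degree `n`. -/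
noncomputable def homologyModule (M : CochainComplex (ModuleCat.{u} R) ℤ) (n : ℤ) :
    ModuleCat.{u} R :=
  M.homology (-n)

/-- The set of degrees `n` such that `H_n(M) ≠ 0`. -/
def homologyDegrees (M : CochainComplex (ModuleCat.{u} R) ℤ) : Set ℤ :=
  {n | Nontrivial (homologyModule M n)}

/-- `M ≃ 0` in `D(R)`: all homology modules of `M` vanish. -/
def IsTrivialComplex (M : CochainComplex (ModuleCat.{u} R) ℤ) : Prop :=
  ∀ n : ℤ, Subsingleton (homologyModule M n)

/-- `M ∈ D_-(R)`: `H_n(M) = 0` for all `n ≫ 0`. -/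
def IsBoundedAbove (M : CochainComplex (ModuleCat.{u} R) ℤ) : Prop :=
  ∃ N : ℤ, ∀ n : ℤ, N < n → Subsingleton (homologyModule M n)

/-- `M ∈ D_+(R)`: `H_n(M) = 0` for all `n ≪ 0`. -/
def IsBoundedBelow (M : CochainComplex (ModuleCat.{u} R) ℤ) : Prop :=
  ∃ N : ℤ, ∀ n : ℤ, n < N → Subsingleton (homologyModule M n)

/-- `sup M = sup {n | H_n(M) ≠ 0}`, an element of `ℤ ∪ {±∞}`. -/
noncomputable def supH (M : CochainComplex (ModuleCat.{u} R) ℤ) : EReal :=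
  ⨆ n ∈ homologyDegrees M, ((n : ℝ) : EReal)

/-- `inf M = inf {n | H_n(M) ≠ 0}`, an element of `ℤ ∪ {±∞}`. -/
noncomputable def infH (M : CochainComplex (ModuleCat.{u} R) ℤ) : EReal :=
  ⨅ n ∈ homologyDegrees M, ((n : ℝ) : EReal)

/-- The complex `Hom_R(X, M)` of `R`-modules, whose term in cohomological degree `n` is
`∏ p, Hom_R(X^p, M^{p+n})` and whose differential is `f ↦ d ∘ f - (-1)^n f ∘ d`. -/
noncomputable def homComplex (X M : CochainComplex (ModuleCat.{u} R) ℤ) :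
    CochainComplex (ModuleCat.{u} R) ℤ where
  X n := ModuleCat.of R (CochainComplex.HomComplex.Cochain X M n)
  d n m := ModuleCat.ofHom (CochainComplex.HomComplex.δ_hom R X M n m)
  shape n m h := by
    apply ModuleCat.hom_ext
    apply LinearMap.ext
    intro z
    exact CochainComplex.HomComplex.δ_shape n m h z
  d_comp_d' n m k _ _ := by
    apply ModuleCat.hom_ext
    apply LinearMap.ext
    intro z
    exact CochainComplex.HomComplex.δ_δ n m k z

/-- A projective resolution of the module `X`, as a complex of projective modules. -/
noncomputable def projRes (X : ModuleCat.{u} R) : CochainComplex (ModuleCat.{u} R) ℤ :=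
  (projectiveResolution X).cochainComplex

/-- `RHom_R(X, M)` for an `R`-module `X` and an `R`-complex `M`: the complex `Hom_R(P, M)` where
`P → X` is a projective resolution. -/
noncomputable def derivedHom (X : ModuleCat.{u} R) (M : CochainComplex (ModuleCat.{u} R) ℤ) :
    CochainComplex (ModuleCat.{u} R) ℤ :=
  homComplex (projRes X) M

/-- `X ⊗ᴸ_R M` for an `R`-module `X` and an `R`-complex `M`: the complex `P ⊗_R M` where
`P → X` is a projective resolution. -/
noncomputable def derivedTensor (X : ModuleCat.{u} R) (M : CochainComplex (ModuleCat.{u} R) ℤ) :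
    CochainComplex (ModuleCat.{u} R) ℤ :=
  HomologicalComplex.tensorObj (projRes X) M

/-- The complex `Hom_R(M, E)` for an `R`-module `E`. -/
noncomputable def homInto (M : CochainComplex (ModuleCat.{u} R) ℤ) (E : ModuleCat.{u} R) :
    CochainComplex (ModuleCat.{u} R) ℤ :=
  homComplex M ((CochainComplex.singleFunctor (ModuleCat.{u} R) 0).obj E)

/-- `D_R(M) = Hom_R(M, ⨁_𝔪 E_R(R/𝔪))`, the sum running over all maximal ideals `𝔪`. -/
noncomputable def dual (M : CochainComplex (ModuleCat.{u} R) ℤ) :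
    CochainComplex (ModuleCat.{u} R) ℤ :=
  homInto M (ModuleCat.of R (⨁ m : MaximalSpectrum R, injectiveHull R (R ⧸ m.asIdeal)))

/-- The localization `M_𝔭`, a complex of `R_𝔭`-modules. -/
noncomputable def localize (p : PrimeSpectrum R) (M : CochainComplex (ModuleCat.{u} R) ℤ) :
    CochainComplex (ModuleCat.{u} (Localization.AtPrime p.asIdeal)) ℤ :=
  ((ModuleCat.localizedModuleFunctor p.asIdeal.primeCompl).mapHomologicalComplex
    (ComplexShape.up ℤ)).obj M

/-- The co-localization `^𝔭M = Hom_{R_𝔭}(D_R(M)_𝔭, E_{R_𝔭}(k(𝔭)))`. -/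
noncomputable def colocalize (p : PrimeSpectrum R) (M : CochainComplex (ModuleCat.{u} R) ℤ) :
    CochainComplex (ModuleCat.{u} (Localization.AtPrime p.asIdeal)) ℤ :=
  homInto (localize p (dual M))
    (injectiveHull (Localization.AtPrime p.asIdeal) p.asIdeal.ResidueField)

/-- For a local ring `R` with residue field `k`: `depth_R M = -sup RHom_R(k, M)`. -/
noncomputable def depth [IsLocalRing R] (M : CochainComplex (ModuleCat.{u} R) ℤ) : EReal :=
  -supH (derivedHom (ModuleCat.of R (IsLocalRing.ResidueField R)) M)

/-- For a local ring `R` with residue field `k`: `width_R M = inf (k ⊗ᴸ_R M)`. -/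
noncomputable def width [IsLocalRing R] (M : CochainComplex (ModuleCat.{u} R) ℤ) : EReal :=
  infH (derivedTensor (ModuleCat.of R (IsLocalRing.ResidueField R)) M)

/-- `Ass_R M`, for `M ∈ D_-(R)`: the primes `𝔭` with `depth M_𝔭 = -sup M_𝔭 < ∞`. -/
def Ass (M : CochainComplex (ModuleCat.{u} R) ℤ) : Set (PrimeSpectrum R) :=
  {p | depth (localize p M) = -supH (localize p M) ∧ -supH (localize p M) < ⊤}

/-- The big cosupport `coSupp_R M`: the primes `𝔭` with `^𝔭M ≄ 0`. -/
def coSupp (M : CochainComplex (ModuleCat.{u} R) ℤ) : Set (PrimeSpectrum R) :=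
  {p | ¬ IsTrivialComplex (colocalize p M)}

/-- `Coass_R M`, for `M ∈ D_+(R)`: the primes `𝔭 ∈ coSupp_R M` with `width ^𝔭M = inf ^𝔭M`. -/
def Coass (M : CochainComplex (ModuleCat.{u} R) ℤ) : Set (PrimeSpectrum R) :=
  {p | p ∈ coSupp M ∧ width (colocalize p M) = infH (colocalize p M)}

/-- The set `Max R` of maximal ideals, inside `Spec R`. -/
def maxSpec (R : Type u) [CommRing R] : Set (PrimeSpectrum R) :=
  {p | p.asIdeal.IsMaximal}

end Complexes

end DerivedAssoc

/-! The hypotheses on `a` and on the maximal ideal `p` serve only to give `a ≤ p`. Degrees are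
cohomological, so "bounded above" means that cohomology vanishes in low degrees.

For Ass, let `c` be the lowest degree in which `M_p` has cohomology. The depth equality says that
`RHom(k(p), M_p)` also has cohomology in degree `c`, and `exists_class_of_homComplex` turns this
into a nonzero class of `H^c(M_p)` killed by the maximal ideal. Clearing denominators
(`exists_class_of_localize`) gives a class `z` of `H^c(M)` with annihilator exactly `p`. As `a ≤ p`,
the rule `1 ↦ z` defines a map from `R ⧸ a` to `H^c(M)`. The obstructions to realizing it by a chain
map from a resolution `P` lie in lower cohomology, which dies at `p`. Finite generation lets one
element outside `p` kill each obstruction, and boundedness leaves finitely many of them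
(`exists_chainMap`). So a multiple of the map by some `t ∉ p` is realized. It is still nonzero on
cohomology, hence gives a nonzero class of `RHom(R ⧸ a, M)`.

For Coass, apply the same construction to the dual `D(M)`. If `H` is the top cohomology of the
colocalization, the width equality forces `H ≠ mH` (`exact_tensor`). By duality with the injective
hull, the lowest cohomology of `D(M)_p` then has a nonzero element killed by the maximal ideal
(`exists_class_of_homInto`). The resulting chain map from `P` to a shift of `D(M)` corresponds under
tensor-hom adjunction to a functional detecting cohomology of `P ⊗ M` (`not_exact_tensor`). -/

namespace DerivedAssoc

/-! ### Cycles, boundaries, resolutions and extremal degrees in terms of elements -/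

section Elements

variable {R : Type u} [CommRing R]

/-- The submodule of cycles in cohomological degree `i`. -/
noncomputable def cyc (M : CochainComplex (ModuleCat.{u} R) ℤ) (i : ℤ) : Submodule R (M.X i) :=
  LinearMap.ker (M.d i (i + 1)).hom

/-- The submodule of boundaries in cohomological degree `i`. -/
noncomputable def bd (M : CochainComplex (ModuleCat.{u} R) ℤ) (i : ℤ) : Submodule R (M.X i) :=
  LinearMap.range (M.d (i - 1) i).hom

theorem mem_cyc {M : CochainComplex (ModuleCat.{u} R) ℤ} {i j : ℤ} (h : i + 1 = j) {z : M.X i} :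
    z ∈ cyc M i ↔ (M.d i j).hom z = 0 := by
  subst h; rfl

theorem mem_bd {M : CochainComplex (ModuleCat.{u} R) ℤ} {i j : ℤ} (h : j + 1 = i) {z : M.X i} :
    z ∈ bd M i ↔ ∃ y, (M.d j i).hom y = z := by
  obtain rfl : j = i - 1 := by omega
  rfl

theorem d_d_apply (M : CochainComplex (ModuleCat.{u} R) ℤ) (i j k : ℤ) (x : M.X i) :
    (M.d j k).hom ((M.d i j).hom x) = 0 := by
  rw [← ModuleCat.comp_apply, M.d_comp_d]; rfl

theorem bd_le_cyc (M : CochainComplex (ModuleCat.{u} R) ℤ) (i : ℤ) : bd M i ≤ cyc M i := by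
  rintro _ ⟨y, rfl⟩
  exact d_d_apply M _ _ _ y

theorem exactAt_iff_cyc_le_bd (M : CochainComplex (ModuleCat.{u} R) ℤ) (i : ℤ) :
    M.ExactAt i ↔ cyc M i ≤ bd M i := by
  rw [M.exactAt_iff' (i - 1) i (i + 1) (by simp) (by simp),
    ShortComplex.moduleCat_exact_iff_ker_sub_range]
  rfl

theorem subsingleton_homologyModule_iff (M : CochainComplex (ModuleCat.{u} R) ℤ) (n i : ℤ)
    (h : n + i = 0) : Subsingleton (homologyModule M n) ↔ cyc M i ≤ bd M i := by
  obtain rfl : i = -n := by omega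
  rw [← exactAt_iff_cyc_le_bd, HomologicalComplex.exactAt_iff_isZero_homology,
    ModuleCat.isZero_iff_subsingleton]
  rfl

theorem mem_homologyDegrees_iff (M : CochainComplex (ModuleCat.{u} R) ℤ) (n i : ℤ)
    (h : n + i = 0) : n ∈ homologyDegrees M ↔ ¬ cyc M i ≤ bd M i := by
  rw [← subsingleton_homologyModule_iff M n i h, not_subsingleton_iff_nontrivial]
  rfl

/-- `P` is a projective resolution of the module `X`, placed in nonpositive degrees. -/
structure IsResolution (P : CochainComplex (ModuleCat.{u} R) ℤ) (X : ModuleCat.{u} R)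
    (π : P.X 0 →ₗ[R] X) : Prop where
  projective : ∀ n, Module.Projective R (P.X n)
  subsingleton : ∀ n : ℤ, 0 < n → Subsingleton (P.X n)
  exact : ∀ n : ℤ, n < 0 → cyc P n ≤ bd P n
  surjective : Function.Surjective π
  ker : LinearMap.ker π = bd P 0

theorem exists_isResolution_cochainComplex {X : ModuleCat.{u} R} (r : ProjectiveResolution X) :
    ∃ π : r.cochainComplex.X 0 →ₗ[R] X, IsResolution r.cochainComplex X π := by
  let e := r.cochainComplexXIso 0 0
  let e1 := r.cochainComplexXIso (-1) 1
  let ρ : r.complex.X 0 ⟶ X := r.π.f 0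
  have hρ : Epi ρ := inferInstanceAs (Epi (r.π.f 0))
  have hex : LinearMap.range (r.complex.d 1 0).hom = LinearMap.ker ρ.hom :=
    (ShortComplex.moduleCat_exact_iff_range_eq_ker _).1 r.exact₀
  have he (x) : e.inv.hom (e.hom.hom x) = x := by
    rw [← ModuleCat.comp_apply, e.hom_inv_id]; rfl
  have he' (x) : e.hom.hom (e.inv.hom x) = x := by
    rw [← ModuleCat.comp_apply, e.inv_hom_id]; rfl
  have he1 (x) : e1.hom.hom (e1.inv.hom x) = x := by
    rw [← ModuleCat.comp_apply, e1.inv_hom_id]; rfl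
  have hd (y) : (r.cochainComplex.d (-1) 0).hom y =
      e.inv.hom ((r.complex.d 1 0).hom (e1.hom.hom y)) := by
    rw [r.cochainComplex_d (-1) 0 1 0]; rfl
  refine ⟨ρ.hom ∘ₗ e.hom.hom, ⟨fun n => ?_, fun n hn => ?_, fun n hn => ?_, ?_, ?_⟩⟩
  · have : Projective (r.cochainComplex.X n) := inferInstance
    exact (IsProjective.iff_projective _).2 this
  · exact ModuleCat.isZero_iff_subsingleton.1
      (CochainComplex.isZero_of_isStrictlyLE r.cochainComplex 0 n hn)
  · exact (exactAt_iff_cyc_le_bd _ _).1 (CochainComplex.exactAt_of_isGE r.cochainComplex 0 n hn)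
  · rw [LinearMap.coe_comp]
    exact ((ModuleCat.epi_iff_surjective ρ).1 hρ).comp fun x => ⟨_, he' x⟩
  · ext x
    rw [mem_bd (j := -1) (by simp), LinearMap.mem_ker, LinearMap.comp_apply, ← LinearMap.mem_ker,
      ← hex]
    constructor
    · rintro ⟨y, hy⟩
      exact ⟨e1.inv.hom y, by rw [hd, he1, hy, he]⟩
    · rintro ⟨y, rfl⟩
      exact ⟨e1.hom.hom y, by rw [hd, he']⟩

theorem exists_isResolution_projRes (X : ModuleCat.{u} R) :
    ∃ π : (projRes X).X 0 →ₗ[R] X, IsResolution (projRes X) X π :=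
  exists_isResolution_cochainComplex _

theorem exists_max_homologyDegrees {M : CochainComplex (ModuleCat.{u} R) ℤ} (hb : IsBoundedAbove M)
    (hne : (homologyDegrees M).Nonempty) :
    ∃ s ∈ homologyDegrees M, (∀ n ∈ homologyDegrees M, n ≤ s) ∧ supH M = ((s : ℝ) : EReal) := by
  obtain ⟨N, hN⟩ := hb
  obtain ⟨s, hs, hmax⟩ := Int.exists_greatest_of_bdd (P := fun n => n ∈ homologyDegrees M)
    ⟨N, fun n hn => by
      by_contra h
      exact not_subsingleton_iff_nontrivial.2 hn (hN n (not_le.1 h))⟩ hne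
  refine ⟨s, hs, hmax, le_antisymm ?_ ?_⟩
  · exact iSup₂_le fun n hn => by exact_mod_cast hmax n hn
  · exact le_iSup₂_of_le s hs le_rfl

/-- A finite supremum of integers is attained: otherwise every degree would be at most `s - 1`. This
is how an equality of depth yields actual cohomology. -/
theorem mem_of_supH_eq {M : CochainComplex (ModuleCat.{u} R) ℤ} {s : ℤ}
    (h : supH M = ((s : ℝ) : EReal)) : s ∈ homologyDegrees M := by
  by_contra hs
  have : supH M ≤ (((s - 1 : ℤ) : ℝ) : EReal) := iSup₂_le fun n hn => by
    have h1 : ((n : ℝ) : EReal) ≤ ((s : ℝ) : EReal) := h ▸ le_iSup₂_of_le n hn le_rfl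
    have h2 : n ≤ s := by exact_mod_cast h1
    have h3 : n ≠ s := fun e => hs (e ▸ hn)
    have h4 : n ≤ s - 1 := by omega
    exact_mod_cast h4
  rw [h] at this
  have h5 : s ≤ s - 1 := by exact_mod_cast this
  omega

theorem exists_min_homologyDegrees {M : CochainComplex (ModuleCat.{u} R) ℤ} (hb : IsBoundedBelow M)
    (hne : (homologyDegrees M).Nonempty) :
    ∃ s ∈ homologyDegrees M, (∀ n ∈ homologyDegrees M, s ≤ n) ∧ infH M = ((s : ℝ) : EReal) := by
  obtain ⟨N, hN⟩ := hb
  obtain ⟨s, hs, hmin⟩ := Int.exists_least_of_bdd (P := fun n => n ∈ homologyDegrees M)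
    ⟨N, fun n hn => by
      by_contra h
      exact not_subsingleton_iff_nontrivial.2 hn (hN n (not_le.1 h))⟩ hne
  refine ⟨s, hs, hmin, le_antisymm ?_ ?_⟩
  · exact iInf₂_le_of_le s hs le_rfl
  · exact le_iInf₂ fun n hn => by exact_mod_cast hmin n hn

theorem mem_of_infH_eq {M : CochainComplex (ModuleCat.{u} R) ℤ} {s : ℤ}
    (h : infH M = ((s : ℝ) : EReal)) : s ∈ homologyDegrees M := by
  by_contra hs
  have : (((s + 1 : ℤ) : ℝ) : EReal) ≤ infH M := le_iInf₂ fun n hn => by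
    have h1 : ((s : ℝ) : EReal) ≤ ((n : ℝ) : EReal) := h ▸ iInf₂_le_of_le n hn le_rfl
    have h2 : s ≤ n := by exact_mod_cast h1
    have h3 : n ≠ s := fun e => hs (e ▸ hn)
    have h4 : s + 1 ≤ n := by omega
    exact_mod_cast h4
  rw [h] at this
  have h5 : s + 1 ≤ s := by exact_mod_cast this
  omega

end Elements

/-! ### Comparison arguments for sequences of projectives -/

section Sequences

/-- Dependent recursion: `Inv` is what makes the next choice possible, and `Rel` is what that choice
achieves. -/
theorem exists_seq {T : ℕ → Type*} (Inv : ∀ j, T j → Prop) (Rel : ∀ j, T j → T (j + 1) → Prop)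
    (x₀ : T 0) (h₀ : Inv 0 x₀) (step : ∀ j x, Inv j x → ∃ y, Inv (j + 1) y ∧ Rel j x y) :
    ∃ f : ∀ j, T j, f 0 = x₀ ∧ ∀ j, Inv j (f j) ∧ Rel j (f j) (f (j + 1)) := by
  choose nxt hnxt using step
  let f : ∀ j, {x : T j // Inv j x} := fun j =>
    Nat.rec ⟨x₀, h₀⟩ (fun j x => ⟨nxt j x.1 x.2, (hnxt j x.1 x.2).1⟩) j
  exact ⟨fun j => (f j).1, rfl, fun j => ⟨(f j).2, (hnxt j _ (f j).2).2⟩⟩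

variable {R : Type u} [CommRing R]

theorem exists_lift {P M N : Type u} [AddCommGroup P] [Module R P] [AddCommGroup M] [Module R M]
    [AddCommGroup N] [Module R N] [Module.Projective R P] (g : M →ₗ[R] N) (f : P →ₗ[R] N)
    (h : LinearMap.range f ≤ LinearMap.range g) : ∃ l : P →ₗ[R] M, g ∘ₗ l = f := by
  obtain ⟨l, hl⟩ := Module.projective_lifting_property g.rangeRestrict
    (f.codRestrict (LinearMap.range g) fun x => h ⟨x, rfl⟩) g.surjective_rangeRestrict
  refine ⟨l, LinearMap.ext fun x => ?_⟩
  exact congrArg Subtype.val (LinearMap.congr_fun hl x)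

/-- A lift through `g` with finitely generated range, if the range of `f` is so. -/
theorem exists_lift_fg {P M N : Type u} [AddCommGroup P] [Module R P] [AddCommGroup M] [Module R M]
    [AddCommGroup N] [Module R N] [Module.Projective R P] 
    [IsNoetherianRing R] (g : M →ₗ[R] N) (f : P →ₗ[R] N)
    (h : LinearMap.range f ≤ LinearMap.range g) (hf : (LinearMap.range f).FG) :
    ∃ l : P →ₗ[R] M, g ∘ₗ l = f ∧ (LinearMap.range l).FG := by
  classical
  obtain ⟨s, hs⟩ := hf
  have hs' : ∀ n ∈ s, ∃ m, g m = n := fun n hn => h (hs ▸ Submodule.subset_span hn)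
  choose! y hy using hs'
  let G : Submodule R M := Submodule.span R (s.image y : Set M)
  obtain ⟨l, hl⟩ := exists_lift (g ∘ₗ G.subtype) f (by
    rw [← hs, Submodule.span_le]
    intro n hn
    exact ⟨⟨y n, Submodule.subset_span (Finset.mem_image_of_mem y hn)⟩, hy n hn⟩)
  exact ⟨G.subtype ∘ₗ l, hl, Submodule.FG.of_le ⟨s.image y, rfl⟩ (by
    rintro _ ⟨x, rfl⟩
    exact (l x).2)⟩

variable {P M : ℕ → Type u} [∀ j, AddCommGroup (P j)] [∀ j, Module R (P j)]
  [∀ j, AddCommGroup (M j)] [∀ j, Module R (M j)] [∀ j, Module.Projective R (P j)]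
  {dP : ∀ j, P (j + 1) →ₗ[R] P j} {dM : ∀ j, M (j + 1) →ₗ[R] M j}

/-- The usual induction: `f (j + 1) - h j ∘ dP j` lands in cycles, hence in boundaries by exactness,
so it lifts through the differential because `P (j + 1)` is projective. -/
theorem exists_nullHomotopy (hP : ∀ j x, dP j (dP (j + 1) x) = 0)
    (hM : ∀ j, LinearMap.ker (dM j) ≤ LinearMap.range (dM (j + 1)))
    (f : ∀ j, P j →ₗ[R] M j) (hf : ∀ j x, dM j (f (j + 1) x) = f j (dP j x))
    (h₀ : LinearMap.range (f 0) ≤ LinearMap.range (dM 0)) :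
    ∃ h : ∀ j, P j →ₗ[R] M (j + 1), (∀ x, f 0 x = dM 0 (h 0 x)) ∧
      ∀ j x, f (j + 1) x = dM (j + 1) (h (j + 1) x) + h j (dP j x) := by
  obtain ⟨k₀, hk₀⟩ := exists_lift (dM 0) (f 0) h₀
  obtain ⟨h, h0, hh⟩ := exists_seq (T := fun j => P j →ₗ[R] M (j + 1))
    (fun j k => ∀ x, dM j (k (dP j x)) = f j (dP j x))
    (fun j k l => ∀ x, f (j + 1) x = dM (j + 1) (l x) + k (dP j x)) k₀
    (fun x => LinearMap.congr_fun hk₀ _) (fun j k hk => by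
      obtain ⟨l, hl⟩ := exists_lift (dM (j + 1)) (f (j + 1) - k ∘ₗ dP j) (by
        refine le_trans ?_ (hM j)
        rintro _ ⟨x, rfl⟩
        simp [hf, hk])
      have hl' : ∀ x, dM (j + 1) (l x) = f (j + 1) x - k (dP j x) := fun x =>
        LinearMap.congr_fun hl x
      exact ⟨l, fun x => by rw [hl', hP]; simp, fun x => by rw [hl']; abel⟩)
  refine ⟨h, fun x => ?_, fun j => (hh j).2⟩
  rw [h0]; exact (LinearMap.congr_fun hk₀ x).symm

/-- Chain maps up to multiplication: a map `f₀` extends to a chain map from a complex of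
projectives, after multiplication by an element of `S`, if the higher homology of the target is
`S`-torsion and vanishes in high degrees. -/
theorem exists_chainMap [IsNoetherianRing R] (S : Submonoid R)
    (hP : ∀ j x, dP j (dP (j + 1) x) = 0)
    (hM : ∀ j, ∀ z ∈ LinearMap.ker (dM j), ∃ t ∈ S, t • z ∈ LinearMap.range (dM (j + 1)))
    (N : ℕ) (hN : ∀ j, N ≤ j → LinearMap.ker (dM j) ≤ LinearMap.range (dM (j + 1)))
    (f₀ : P 0 →ₗ[R] M 0) (hfg : (LinearMap.range f₀).FG)
    (h₀ : ∀ x, f₀ (dP 0 x) ∈ LinearMap.range (dM 0)) :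
    ∃ f : ∀ j, P j →ₗ[R] M j, (∀ j x, dM j (f (j + 1) x) = f j (dP j x)) ∧
      ∃ t ∈ S, f 0 = t • f₀ := by
  -- A finitely generated module of cycles is pushed into boundaries by one element, the product
  -- over generators. It is taken to be `1` from degree `N` on, so only finitely many multipliers
  -- matter.
  have key : ∀ j, ∀ G : Submodule R (M (j + 1)), G.FG → G ≤ LinearMap.ker (dM j) →
      ∃ t ∈ S, (N ≤ j → t = 1) ∧ ∀ z ∈ G, t • z ∈ LinearMap.range (dM (j + 1)) := by
    intro j G hG hGk
    by_cases hj : N ≤ j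
    · exact ⟨1, S.one_mem, fun _ => rfl, fun z hz => by simpa using hN j hj (hGk hz)⟩
    classical
    obtain ⟨s, rfl⟩ := hG
    have hMj : ∀ z : M (j + 1), z ∈ LinearMap.ker (dM j) → ∃ t : R, t ∈ S ∧
        t • z ∈ LinearMap.range (dM (j + 1)) := hM j
    choose! t ht using hMj
    refine ⟨∏ z ∈ s, t z, S.prod_mem fun z hz => (ht z (hGk (Submodule.subset_span hz))).1,
      fun h => absurd h hj, fun z hz => ?_⟩
    suffices Submodule.span R (s : Set (M (j + 1))) ≤
        (LinearMap.range (dM (j + 1))).comap (LinearMap.lsmul R _ (∏ z ∈ s, t z)) from this hz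
    rw [Submodule.span_le]
    intro z hz
    have hz' : z ∈ s := hz
    change (∏ z ∈ s, t z) • z ∈ LinearMap.range (dM (j + 1))
    rw [← Finset.prod_erase_mul s t hz', mul_smul]
    exact Submodule.smul_mem _ _ (ht z (hGk (Submodule.subset_span hz))).2
  obtain ⟨F, hF0, hF⟩ := exists_seq (T := fun j => (P j →ₗ[R] M j) × R)
    -- The state is a map together with the multiplier that makes its composite with `dP j`
    -- liftable. The multiplier at `j + 1` comes from `key j`, hence the bound `N + 1`.
    (fun j a => (LinearMap.range a.1).FG ∧ a.2 ∈ S ∧ (N + 1 ≤ j → a.2 = 1) ∧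
      ∀ x, a.2 • a.1 (dP j x) ∈ LinearMap.range (dM j))
    (fun j a b => ∀ x, dM j (b.1 x) = a.2 • a.1 (dP j x)) (f₀, 1)
    ⟨hfg, S.one_mem, fun _ => rfl, fun x => by simpa using h₀ x⟩ (by
      rintro j ⟨f, r⟩ ⟨hf, hr, -, hfr⟩
      obtain ⟨g, hg, hgf⟩ := exists_lift_fg (dM j) (r • f ∘ₗ dP j)
        (by rintro _ ⟨x, rfl⟩; exact hfr x)
        (Submodule.FG.of_le hf (by
          rintro _ ⟨x, rfl⟩
          exact Submodule.smul_mem _ _ ⟨_, rfl⟩))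
      have hg' : ∀ x, dM j (g x) = r • f (dP j x) := fun x => LinearMap.congr_fun hg x
      obtain ⟨t, ht, ht1, htG⟩ := key j (LinearMap.range (g ∘ₗ dP (j + 1)))
        (Submodule.FG.of_le hgf (LinearMap.range_comp_le_range _ _))
        (by rintro _ ⟨x, rfl⟩; simp [hg', hP])
      exact ⟨(g, t), ⟨hgf, ht, fun h => ht1 (by omega), fun x => htG _ ⟨x, rfl⟩⟩, hg'⟩)
  -- Multiplying the `j`-th map by all multipliers from `j` on makes the defects telescope, leaving
  -- a genuine chain map.
  refine ⟨fun j => (∏ i ∈ Finset.Ico j (N + 1), (F i).2) • (F j).1, fun j x => ?_,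
    ∏ i ∈ Finset.Ico 0 (N + 1), (F i).2, S.prod_mem fun i _ => (hF i).1.2.1, by simp only [hF0]⟩
  have h1 := (hF j).2 x
  by_cases hj : j < N + 1
  · simp only [LinearMap.smul_apply, map_smul, h1]
    rw [Finset.prod_eq_prod_Ico_succ_bot hj, mul_comm, mul_smul]
  · simp only [LinearMap.smul_apply, map_smul, h1, (hF j).1.2.2.1 (not_lt.1 hj), one_smul]
    rw [Finset.Ico_eq_empty (by omega), Finset.Ico_eq_empty (by omega)]

end Sequences

/-! ### Classes in Hom complexes and chain maps out of a resolution -/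

section HomComplexes

open CochainComplex.HomComplex

variable {R : Type u} [CommRing R] {P M : CochainComplex (ModuleCat.{u} R) ℤ}

theorem mem_cyc_homComplex {n : ℤ} {α : Cochain P M n} :
    α ∈ cyc (homComplex P M) n ↔ δ n (n + 1) α = 0 :=
  Iff.rfl

theorem mem_bd_homComplex {n m : ℤ} (h : m + 1 = n) {α : Cochain P M n} :
    α ∈ bd (homComplex P M) n ↔ ∃ β : Cochain P M m, δ m n β = α := by
  obtain rfl : m = n - 1 := by omega
  rfl

theorem cochain_ext (hP : ∀ n : ℤ, 0 < n → Subsingleton (P.X n)) {n : ℤ} {α β : Cochain P M n}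
    (t : ℕ → ℤ) (ht : ∀ j : ℕ, -(j : ℤ) + n = t j)
    (h : ∀ (j : ℕ) x, (α.v (-j) (t j) (ht j)).hom x = (β.v (-j) (t j) (ht j)).hom x) :
    α = β := by
  ext p q hpq x
  by_cases hp : 0 < p
  · have := hP p hp
    rw [Subsingleton.elim x 0, map_zero, map_zero]
  · obtain ⟨j, rfl⟩ : ∃ j : ℕ, p = -j := ⟨p.natAbs, by omega⟩
    obtain rfl : q = t j := by rw [← ht, hpq]
    exact h j x

/-- The free index function `t` allows targets such as `c - (j + 1)` to be used in the form in which
they arise, without casts. -/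
theorem exists_cochain {n : ℤ} (t : ℕ → ℤ) (ht : ∀ j : ℕ, -(j : ℤ) + n = t j)
    (f : ∀ j : ℕ, P.X (-j) →ₗ[R] M.X (t j)) :
    ∃ α : Cochain P M n, ∀ j : ℕ, (α.v (-j) (t j) (ht j)).hom = f j := by
  have aux : ∀ p q : ℤ, p + n = q → ∃ u : P.X p ⟶ M.X q, ∀ (j : ℕ) (hj : p = -j) (hq : q = t j),
      u = (P.XIsoOfEq hj).hom ≫ ModuleCat.ofHom (f j) ≫ (M.XIsoOfEq hq).inv := by
    intro p q hpq
    by_cases hp : 0 < p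
    · exact ⟨0, fun j hj => by omega⟩
    · obtain ⟨j, rfl⟩ : ∃ j : ℕ, p = -j := ⟨p.natAbs, by omega⟩
      obtain rfl : q = t j := by rw [← ht, hpq]
      refine ⟨ModuleCat.ofHom (f j), fun k hk _ => ?_⟩
      obtain rfl : j = k := by omega
      simp
  choose u hu using aux
  refine ⟨Cochain.mk u, fun j => ?_⟩
  rw [Cochain.mk_v, hu _ _ _ j rfl rfl]
  simp

/-- Allows the augmentation to be used in degree `-(0 : ℕ)`, where families indexed by `ℕ` begin. -/
theorem IsResolution.exists_augmentation {X : ModuleCat.{u} R} {π : P.X 0 →ₗ[R] X}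
    (hP : IsResolution P X π) {i j : ℤ} (hi : i = 0) (hj : j + 1 = i) :
    ∃ π' : P.X i →ₗ[R] X, Function.Surjective π' ∧
      ∀ x, π' x = 0 ↔ ∃ y, (P.d j i).hom y = x := by
  subst hi
  refine ⟨π, hP.surjective, fun x => ?_⟩
  rw [← mem_bd hj, ← hP.ker, LinearMap.mem_ker]

theorem δ_apply {n m : ℤ} (h : n + 1 = m) (α : Cochain P M n) (p q p' q' : ℤ) (hpq : p + m = q)
    (hp : p + 1 = p') (hq : q' + 1 = q) (x : P.X p) :
    ((δ n m α).v p q hpq).hom x = (M.d q' q).hom ((α.v p q' (by omega)).hom x) +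
      m.negOnePow • (α.v p' q (by omega)).hom ((P.d p p').hom x) := by
  rw [δ_v n m h α p q hpq q' p' (by omega) hp]
  rfl

/-- A nonzero class in the cohomology of `Hom(P, M)`, in the lowest degree in which `M` may have
cohomology, gives a nonzero class of `M` killed by the annihilator of `X`. -/
theorem exists_class_of_homComplex {X : ModuleCat.{u} R} {π : P.X 0 →ₗ[R] X}
    (hP : IsResolution P X π) {c : ℤ} (hM : ∀ j < c, cyc M j ≤ bd M j)
    (h : ¬ cyc (homComplex P M) c ≤ bd (homComplex P M) c) :
    ∃ z ∈ cyc M c, z ∉ bd M c ∧ ∀ r : R, (∀ x : X, r • x = 0) → r • z ∈ bd M c := by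
  obtain ⟨α, hα', hαb⟩ : ∃ α : Cochain P M c, δ c (c + 1) α = 0 ∧
      ∀ β : Cochain P M (c - 1), δ (c - 1) c β ≠ α := by
    obtain ⟨α, hα, hαb⟩ := SetLike.not_le_iff_exists.1 h
    exact ⟨α, hα, fun β hβ => hαb ⟨β, hβ⟩⟩
  have hα (p q p' q' : ℤ) (hpq : p + c = q) (hp : p + 1 = p') (hq : q + 1 = q') (x : P.X p) :
      (M.d q q').hom ((α.v p q hpq).hom x) =
        c.negOnePow • (α.v p' q' (by omega)).hom ((P.d p p').hom x) := by
    have := δ_apply rfl α p q' p' q (by omega) hp hq x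
    rw [hα', Int.negOnePow_succ] at this
    rw [← sub_eq_zero]
    simpa [sub_eq_add_neg] using this.symm
  let s : ℤˣ := c.negOnePow
  have hss : s * s = 1 := Int.units_mul_self s
  -- A cocycle commutes with differentials up to `(-1)^c`; the factor `s ^ j` turns it into a chain
  -- map.
  let f : ∀ j : ℕ, P.X (-j) →ₗ[R] M.X (c - j) := fun j =>
    (s ^ j) • (α.v (-j) (c - j) (by omega)).hom
  have hf (j : ℕ) (x : P.X (-(j + 1 : ℕ))) :
      (M.d (c - (j + 1 : ℕ)) (c - j)).hom (f (j + 1) x) =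
        f j ((P.d (-(j + 1 : ℕ)) (-j)).hom x) := by
    change (M.d _ _).hom (s ^ (j + 1) • (α.v _ _ _).hom x) = s ^ j • (α.v _ _ _).hom _
    rw [LinearMap.map_smul_of_tower, hα _ _ (-j) _ _ (by push_cast; ring) (by push_cast; ring),
      smul_smul, pow_succ, mul_assoc, hss, mul_one]
  -- If `f 0` landed in boundaries, exactness of `M` below `c` would make `f` null-homotopic, and
  -- the homotopy with its signs restored would exhibit `α` as a coboundary.
  have hnb : ∃ e, f 0 e ∉ LinearMap.range (M.d (c - (0 + 1 : ℕ)) (c - (0 : ℕ))).hom := by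
    by_contra! hb
    have hproj : ∀ j : ℕ, Module.Projective R (P.X (-j)) := fun j => hP.projective _
    obtain ⟨k, hk0, hk⟩ := exists_nullHomotopy (P := fun j : ℕ => P.X (-j))
      (M := fun j : ℕ => M.X (c - j)) (dP := fun j => (P.d (-(j + 1 : ℕ)) (-j)).hom)
      (dM := fun j => (M.d (c - (j + 1 : ℕ)) (c - j)).hom) (fun j x => d_d_apply _ _ _ _ _)
      (fun j z hz => (mem_bd (by push_cast; ring)).1
        (hM _ (by push_cast; omega) ((mem_cyc (by push_cast; ring)).2 hz)))
      f hf (by rintro _ ⟨e, rfl⟩; exact hb e)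
    obtain ⟨β, hβ⟩ := exists_cochain (P := P) (M := M) (n := c - 1) (fun j => c - (j + 1 : ℕ))
      (fun j => by push_cast; ring) (fun j => (s ^ j) • k j)
    refine hαb β (cochain_ext hP.subsingleton (fun j => c - j) (fun j => by ring) fun j x => ?_)
    have hsf : (α.v (-j) (c - j) (by omega)).hom x = s ^ j • f j x := by
      change _ = s ^ j • s ^ j • (α.v _ _ _).hom x
      rw [smul_smul, ← mul_pow, hss, one_pow, one_smul]
    rw [hsf]
    cases j with
    | zero =>
      have := hP.subsingleton (-(0 : ℕ) + 1) (by simp)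
      rw [δ_apply (by ring) β _ _ (-(0 : ℕ) + 1) (c - (0 + 1 : ℕ)) (by simp) rfl
        (by push_cast; ring), hβ, hk0, Subsingleton.elim ((P.d _ _).hom x) 0, map_zero, smul_zero,
        add_zero, pow_zero, one_smul, one_smul]
    | succ j =>
      rw [δ_apply (by ring) β _ _ (-j) (c - (j + 1 + 1 : ℕ)) (by push_cast; ring)
        (by push_cast; ring) (by push_cast; ring), hβ, hβ, hk, smul_add,
        LinearMap.smul_apply, LinearMap.smul_apply, LinearMap.map_smul_of_tower,
        show c.negOnePow = s from rfl, smul_smul s, ← pow_succ']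
  obtain ⟨e, he⟩ := hnb
  have key : ∀ c', c' = c → (∃ z ∈ cyc M c', z ∉ bd M c' ∧
      ∀ r : R, (∀ x : X, r • x = 0) → r • z ∈ bd M c') →
      ∃ z ∈ cyc M c, z ∉ bd M c ∧ ∀ r : R, (∀ x : X, r • x = 0) → r • z ∈ bd M c := by
    rintro _ rfl h; exact h
  refine key (c - (0 : ℕ)) (by simp) ⟨f 0 e, ?_, ?_, ?_⟩
  · rw [mem_cyc rfl]
    change (M.d _ _).hom (s ^ 0 • (α.v _ _ _).hom e) = 0
    have := hP.subsingleton (-(0 : ℕ) + 1) (by simp)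
    rw [pow_zero, one_smul, hα _ _ (-(0 : ℕ) + 1) _ _ rfl rfl,
      Subsingleton.elim ((P.d _ _).hom e) 0, map_zero, smul_zero]
  · rwa [mem_bd (j := c - (0 + 1 : ℕ)) (by push_cast; ring)]
  -- As `r` kills `X`, the element `r • e` is a boundary of `P`, and `f` carries boundaries to
  -- boundaries.
  · intro r hr
    obtain ⟨π', -, hπ'⟩ := hP.exists_augmentation (i := -(0 : ℕ)) (j := -(0 + 1 : ℕ)) (by simp)
      (by simp)
    obtain ⟨y, hy⟩ := (hπ' (r • e)).1 (by rw [map_smul, hr])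
    rw [mem_bd (j := c - (0 + 1 : ℕ)) (by push_cast; ring)]
    exact ⟨f 1 y, by rw [← map_smul, ← hy]; exact hf 0 y⟩

/-- With signs inserted, `f` is a cocycle. Were it the coboundary of `β`, then since `P` vanishes in
degree `1` the equation at `e` would read `f 0 e = d (β e)`. -/
theorem not_exact_homComplex {c : ℤ} (hP : ∀ n : ℤ, 0 < n → Subsingleton (P.X n))
    (f : ∀ j : ℕ, P.X (-j) →ₗ[R] M.X (c - j))
    (hf : ∀ (j : ℕ) x, (M.d (c - (j + 1 : ℕ)) (c - j)).hom (f (j + 1) x) =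
      f j ((P.d (-(j + 1 : ℕ)) (-j)).hom x))
    (h₀ : ∀ x, f 0 x ∈ cyc M (c - (0 : ℕ))) (e : P.X (-(0 : ℕ)))
    (he : f 0 e ∉ bd M (c - (0 : ℕ))) :
    ¬ cyc (homComplex P M) c ≤ bd (homComplex P M) c := by
  intro h
  let s : ℤˣ := c.negOnePow
  have hss : s * s = 1 := Int.units_mul_self s
  have hs0 := hP (-(0 : ℕ) + 1) (by simp)
  obtain ⟨α, hα⟩ := exists_cochain (P := P) (M := M) (n := c) (fun j => c - j)
    (fun j => by ring) (fun j => (s ^ j) • f j)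
  have hcyc : δ c (c + 1) α = 0 := by
    refine cochain_ext hP (fun j => c - j + 1) (fun j => by ring) fun j x => ?_
    cases j with
    | zero =>
      rw [δ_apply rfl α _ _ (-(0 : ℕ) + 1) (c - (0 : ℕ)) (by simp) rfl rfl,
        Subsingleton.elim ((P.d _ _).hom x) 0, map_zero, smul_zero, add_zero, hα,
        LinearMap.smul_apply, pow_zero, one_smul, (mem_cyc rfl).1 (h₀ x)]
      rfl
    | succ j =>
      have key : ∀ q (hq : q = c - j), (α.v (-j) q (by omega)).hom
          ((P.d (-(j + 1 : ℕ)) (-j)).hom x) =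
          s ^ j • (M.d (c - (j + 1 : ℕ)) q).hom (f (j + 1) x) := by
        rintro _ rfl
        rw [hα, hf, LinearMap.smul_apply]
      rw [δ_apply rfl α _ _ (-j) (c - (j + 1 : ℕ)) (by push_cast; ring) (by push_cast; ring) rfl,
        hα, key _ (by push_cast; ring), LinearMap.smul_apply, LinearMap.map_smul_of_tower,
        Int.negOnePow_succ, show c.negOnePow = s from rfl, smul_smul, neg_mul, ← pow_succ',
        Units.neg_smul, add_neg_cancel]
      rfl
  obtain ⟨β, hβ⟩ := (mem_bd_homComplex (m := c - 1) (by ring)).1 (h (mem_cyc_homComplex.2 hcyc))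
  apply he
  have h1 := δ_apply (by ring) β (-(0 : ℕ)) (c - (0 : ℕ)) (-(0 : ℕ) + 1) (c - (0 + 1 : ℕ))
    (by simp) rfl (by push_cast; ring) e
  rw [hβ, hα, Subsingleton.elim ((P.d _ _).hom e) 0, map_zero, smul_zero, add_zero,
    LinearMap.smul_apply, pow_zero, one_smul] at h1
  exact (mem_bd (by push_cast; ring)).2 ⟨_, h1.symm⟩

/-- A class of `M` killed by `a` and not killed by any element outside `p` extends to a chain map
from a resolution of `R ⧸ a`, if lower cohomology of `M` vanishes at `p`. -/
theorem exists_chainMap_resolution [IsNoetherianRing R] {a p : Ideal R} [p.IsPrime] (hap : a ≤ p)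
    {π : P.X 0 →ₗ[R] ModuleCat.of R (R ⧸ a)} (hP : IsResolution P _ π)
    {c N : ℤ} (hN : ∀ j < N, cyc M j ≤ bd M j)
    (htor : ∀ j < c, ∀ z ∈ cyc M j, ∃ t ∈ p.primeCompl, t • z ∈ bd M j)
    {z : M.X c} (hz : z ∈ cyc M c) (hzb : ∀ t ∈ p.primeCompl, t • z ∉ bd M c)
    (hpz : ∀ r ∈ p, r • z ∈ bd M c) :
    ∃ f : ∀ j : ℕ, P.X (-j) →ₗ[R] M.X (c - j),
      (∀ (j : ℕ) x, (M.d (c - (j + 1 : ℕ)) (c - j)).hom (f (j + 1) x) =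
        f j ((P.d (-(j + 1 : ℕ)) (-j)).hom x)) ∧
      (∀ x, f 0 x ∈ cyc M (c - (0 : ℕ))) ∧ ∃ e, f 0 e ∉ bd M (c - (0 : ℕ)) := by
  obtain ⟨π', hπs, hπ'⟩ := hP.exists_augmentation (i := -(0 : ℕ)) (j := -(0 + 1 : ℕ)) (by simp)
    (by simp)
  have hproj : ∀ j : ℕ, Module.Projective R (P.X (-j)) := fun j => hP.projective _
  -- Lifting the augmentation to `R` represents the map `1 ↦ [z]` on cochains by `x ↦ l x • z`.
  obtain ⟨l, hl⟩ : ∃ l : P.X (-(0 : ℕ)) →ₗ[R] R, ∀ x, Ideal.Quotient.mk a (l x) = π' x := by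
    have := hproj 0
    obtain ⟨l, hl⟩ := Module.projective_lifting_property a.mkQ π' a.mkQ_surjective
    exact ⟨l, fun x => LinearMap.congr_fun hl x⟩
  obtain ⟨z, hz, hzb, hpz⟩ : ∃ z : M.X (c - (0 : ℕ)), z ∈ cyc M (c - (0 : ℕ)) ∧
      (∀ t ∈ p.primeCompl, t • z ∉ bd M (c - (0 : ℕ))) ∧ ∀ r ∈ p, r • z ∈ bd M (c - (0 : ℕ)) := by
    have key : ∀ c', c' = c → ∃ z : M.X c', z ∈ cyc M c' ∧
      (∀ t ∈ p.primeCompl, t • z ∉ bd M c') ∧ ∀ r ∈ p, r • z ∈ bd M c' := by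
      rintro _ rfl
      exact ⟨z, hz, hzb, hpz⟩
    exact key _ (by simp)
  obtain ⟨f, hf, t, ht, hf0⟩ := exists_chainMap (P := fun j : ℕ => P.X (-j))
      (M := fun j : ℕ => M.X (c - j)) (dP := fun j => (P.d (-(j + 1 : ℕ)) (-j)).hom)
      (dM := fun j => (M.d (c - (j + 1 : ℕ)) (c - j)).hom) p.primeCompl
      (fun j x => d_d_apply _ _ _ _ _)
      (fun j z hz => by
        obtain ⟨t, ht, htz⟩ := htor _ (by push_cast; omega)
          z ((mem_cyc (by push_cast; ring)).2 hz)
        exact ⟨t, ht, (mem_bd (by push_cast; ring)).1 htz⟩)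
      (c - N).toNat
      (fun j hj z hz => (mem_bd (by push_cast; ring)).1
        (hN _ (by push_cast; omega) ((mem_cyc (by push_cast; ring)).2 hz)))
      (LinearMap.toSpanSingleton R _ z ∘ₗ l)
      (Submodule.FG.of_le (Submodule.fg_span_singleton z) (by
        rintro _ ⟨x, rfl⟩
        exact Submodule.smul_mem _ _ (Submodule.mem_span_singleton_self z)))
      (fun x => by
        refine (mem_bd (by push_cast; ring)).1 (hpz _ (hap ?_))
        exact Ideal.Quotient.eq_zero_iff_mem.1 ((hl _).trans ((hπ' _).2 ⟨x, rfl⟩)))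
  have hf0' : ∀ x, f 0 x = t • l x • z := fun x => by rw [hf0]; rfl
  refine ⟨f, hf, fun x => ?_, ?_⟩
  · rw [hf0']
    exact Submodule.smul_mem _ _ (Submodule.smul_mem _ _ hz)
  -- For `e` over `1`, `l e ≡ 1` modulo `a ≤ p`, so `t * l e` lies outside `p` and cannot carry `z`
  -- into the boundaries.
  · obtain ⟨e, he⟩ := hπs (Ideal.Quotient.mk a 1)
    refine ⟨e, fun hb => ?_⟩
    rw [hf0', smul_smul] at hb
    refine hzb _ (p.primeCompl.mul_mem ht fun hle => ?_) hb
    have h1 : l e - 1 ∈ a := Ideal.Quotient.eq.1 ((hl e).trans he)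
    exact Ideal.IsPrime.one_notMem ‹_› (by simpa using p.sub_mem hle (hap h1))

end HomComplexes

/-! ### Localization by clearing denominators, and the Ass case -/

section Localize

variable {R : Type u} [CommRing R] (p : PrimeSpectrum R)

theorem exists_toLocalize (M : CochainComplex (ModuleCat.{u} R) ℤ) :
    ∃ ι : ∀ j, M.X j →+ (localize p M).X j,
      (∀ j w, ∃ m, ∃ t ∈ p.asIdeal.primeCompl,
        algebraMap R (Localization.AtPrime p.asIdeal) t • w = ι j m) ∧
      (∀ j m, ι j m = 0 ↔ ∃ t ∈ p.asIdeal.primeCompl, t • m = 0) ∧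
      (∀ i j m, ((localize p M).d i j).hom (ι i m) = ι j ((M.d i j).hom m)) ∧
      ∀ j (r : R) m, ι j (r • m) = algebraMap R (Localization.AtPrime p.asIdeal) r • ι j m := by
  let S := p.asIdeal.primeCompl
  refine ⟨fun j => ((M.X j).localizedModuleMkLinearMap S).toAddMonoidHom, fun j w => ?_,
    fun j m => ?_, fun i j m => ?_, fun j r m => ?_⟩
  · obtain ⟨⟨m, t⟩, h⟩ := IsLocalizedModule.surj S ((M.X j).localizedModuleMkLinearMap S) w
    refine ⟨m, t, t.2, ?_⟩
    exact (algebraMap_smul (M := (M.X j).localizedModule S) (Localization S) (t : R) w).trans h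
  · refine (IsLocalizedModule.eq_zero_iff S ((M.X j).localizedModuleMkLinearMap S)).trans ?_
    exact ⟨fun ⟨t, ht⟩ => ⟨t, t.2, ht⟩, fun ⟨t, ht, h⟩ => ⟨⟨t, ht⟩, h⟩⟩
  · exact IsLocalizedModule.map_apply S ((M.X i).localizedModuleMkLinearMap S)
      ((M.X j).localizedModuleMkLinearMap S) (M.d i j).hom m
  · refine (map_smul ((M.X j).localizedModuleMkLinearMap S) r m).trans ?_
    exact (algebraMap_smul (M := (M.X j).localizedModule S) (Localization S) r
      ((M.X j).localizedModuleMkLinearMap S m)).symm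

theorem smul_mem_iff_of_notMem {N : Type u} [AddCommGroup N]
    [Module (Localization.AtPrime p.asIdeal) N] (B : Submodule (Localization.AtPrime p.asIdeal) N)
    {t : R} (ht : t ∈ p.asIdeal.primeCompl) {x : N} :
    algebraMap R (Localization.AtPrime p.asIdeal) t • x ∈ B ↔ x ∈ B :=
  B.smul_mem_iff_of_isUnit
    (IsLocalization.map_units (Localization.AtPrime p.asIdeal) (⟨t, ht⟩ : p.asIdeal.primeCompl))

variable {p} {M : CochainComplex (ModuleCat.{u} R) ℤ}

theorem exact_localize {j : ℤ} (h : cyc M j ≤ bd M j) :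
    cyc (localize p M) j ≤ bd (localize p M) j := by
  obtain ⟨ι, hs, hz, hd, hsm⟩ := exists_toLocalize p M
  intro w hw
  obtain ⟨m, t, ht, htw⟩ := hs j w
  have h1 : ι _ ((M.d j (j + 1)).hom m) = 0 := by
    rw [← hd, ← htw, map_smul, (mem_cyc rfl).1 hw, smul_zero]
  obtain ⟨t', ht', h2⟩ := (hz _ _).1 h1
  obtain ⟨y, hy⟩ := h (x := t' • m) ((mem_cyc rfl).2 (by rw [map_smul, h2]))
  rw [← smul_mem_iff_of_notMem p _ ht, ← smul_mem_iff_of_notMem p _ ht', htw, ← hsm, ← hy, ← hd]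
  exact ⟨_, rfl⟩

theorem exists_smul_mem_bd_of_mem_bd_localize {j : ℤ}
    {ι : ∀ j, M.X j →+ (localize p M).X j}
    (hs : ∀ j w, ∃ m, ∃ t ∈ p.asIdeal.primeCompl,
      algebraMap R (Localization.AtPrime p.asIdeal) t • w = ι j m)
    (hz : ∀ j m, ι j m = 0 ↔ ∃ t ∈ p.asIdeal.primeCompl, t • m = 0)
    (hd : ∀ i j m, ((localize p M).d i j).hom (ι i m) = ι j ((M.d i j).hom m))
    (hsm : ∀ j (r : R) m, ι j (r • m) =
      algebraMap R (Localization.AtPrime p.asIdeal) r • ι j m)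
    {m : M.X j} (h : ι j m ∈ bd (localize p M) j) :
    ∃ t ∈ p.asIdeal.primeCompl, t • m ∈ bd M j := by
  obtain ⟨w, hw⟩ := h
  obtain ⟨y, t, ht, hy⟩ := hs _ w
  have h1 : ι j (t • m - (M.d (j - 1) j).hom y) = 0 := by
    rw [map_sub, hsm, ← hd, ← hy, map_smul, hw, sub_self]
  obtain ⟨t', ht', h2⟩ := (hz _ _).1 h1
  refine ⟨t' * t, mul_mem ht' ht, t' • y, ?_⟩
  rw [map_smul, mul_smul]
  rw [smul_sub, sub_eq_zero] at h2
  exact h2.symm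

theorem exists_smul_mem_bd_of_exact_localize {j : ℤ}
    (h : cyc (localize p M) j ≤ bd (localize p M) j) {z : M.X j} (hz : z ∈ cyc M j) :
    ∃ t ∈ p.asIdeal.primeCompl, t • z ∈ bd M j := by
  obtain ⟨ι, hs, hz', hd, hsm⟩ := exists_toLocalize p M
  refine exists_smul_mem_bd_of_mem_bd_localize hs hz' hd hsm (h ((mem_cyc rfl).2 ?_))
  rw [hd, (mem_cyc rfl).1 hz, map_zero]

/-- Multiply `w` successively by elements outside `p`: `t` to bring it from `M`, `t'` to make it a
cycle, and `T` so that a finite set of generators of `p` sends it into boundaries. All of these are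
units at `p`, so the class survives further multiplication by any element outside `p`. -/
theorem exists_class_of_localize [IsNoetherianRing R] {c : ℤ} {w : (localize p M).X c}
    (hw : w ∈ cyc (localize p M) c) (hwb : w ∉ bd (localize p M) c)
    (hpw : ∀ r ∈ IsLocalRing.maximalIdeal (Localization.AtPrime p.asIdeal),
      r • w ∈ bd (localize p M) c) :
    ∃ z ∈ cyc M c, (∀ t ∈ p.asIdeal.primeCompl, t • z ∉ bd M c) ∧
      ∀ r ∈ p.asIdeal, r • z ∈ bd M c := by
  obtain ⟨ι, hs, hz, hd, hsm⟩ := exists_toLocalize p M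
  obtain ⟨m, t, ht, htw⟩ := hs c w
  have h1 : ι _ ((M.d c (c + 1)).hom m) = 0 := by
    rw [← hd, ← htw, map_smul, (mem_cyc rfl).1 hw, smul_zero]
  obtain ⟨t', ht', h2⟩ := (hz _ _).1 h1
  have hp : ∀ r ∈ p.asIdeal, ∃ s ∈ p.asIdeal.primeCompl, s • r • m ∈ bd M c := by
    intro r hr
    apply exists_smul_mem_bd_of_mem_bd_localize hs hz hd hsm
    rw [hsm, ← htw, smul_comm]
    exact Submodule.smul_mem _ _
      (hpw _ ((IsLocalization.AtPrime.to_map_mem_maximal_iff _ p.asIdeal _).2 hr))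
  obtain ⟨G, hG⟩ := IsNoetherian.noetherian p.asIdeal
  have hp' : ∀ r : R, r ∈ G → ∃ s : R, s ∈ p.asIdeal.primeCompl ∧ s • r • m ∈ bd M c :=
    fun r hr => hp r (hG ▸ Submodule.subset_span hr)
  choose! s hs' using hp'
  have hT : ∏ r ∈ G, s r ∈ p.asIdeal.primeCompl := Submonoid.prod_mem _ fun r hr => (hs' r hr).1
  set T := ∏ r ∈ G, s r with hTdef
  refine ⟨T • t' • m, Submodule.smul_mem _ _ ((mem_cyc rfl).2 (by rw [map_smul, h2])),
    fun r hr hb => hwb ?_, ?_⟩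
  · rw [← smul_mem_iff_of_notMem p _ ht, htw, ← smul_mem_iff_of_notMem p _ ht', ← hsm,
      ← smul_mem_iff_of_notMem p _ hT, ← hsm, ← smul_mem_iff_of_notMem p _ hr, ← hsm]
    obtain ⟨y, hy⟩ := hb
    exact ⟨ι _ y, by rw [hd, hy]⟩
  · suffices p.asIdeal ≤ (bd M c).comap (LinearMap.toSpanSingleton R _ (T • t' • m)) from this
    rw [← hG, Submodule.span_le]
    intro r hr
    change r • T • t' • m ∈ bd M c
    classical
    have h3 : r • T • t' • m = (∏ x ∈ G.erase r, s x) • t' • s r • r • m := by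
      simp only [smul_smul]
      rw [hTdef, ← Finset.mul_prod_erase G s hr]
      congr 1
      ring
    rw [h3]
    exact Submodule.smul_mem _ _ (Submodule.smul_mem _ _ (hs' r hr).2)

/-- Nonvanishing of `RHom(R ⧸ a, M)` at a class which is detected at a prime containing `a`. -/
theorem exists_chainMap_of_localize [IsNoetherianRing R] {a : Ideal R} (hap : a ≤ p.asIdeal)
    {P : CochainComplex (ModuleCat.{u} R) ℤ} {π : P.X 0 →ₗ[R] ModuleCat.of R (R ⧸ a)}
    (hP : IsResolution P _ π) {c N : ℤ} (hN : ∀ j < N, cyc M j ≤ bd M j)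
    (hc : ∀ j < c, cyc (localize p M) j ≤ bd (localize p M) j) {w : (localize p M).X c}
    (hw : w ∈ cyc (localize p M) c) (hwb : w ∉ bd (localize p M) c)
    (hpw : ∀ r ∈ IsLocalRing.maximalIdeal (Localization.AtPrime p.asIdeal),
      r • w ∈ bd (localize p M) c) :
    ∃ f : ∀ j : ℕ, P.X (-j) →ₗ[R] M.X (c - j),
      (∀ (j : ℕ) x, (M.d (c - (j + 1 : ℕ)) (c - j)).hom (f (j + 1) x) =
        f j ((P.d (-(j + 1 : ℕ)) (-j)).hom x)) ∧
      (∀ x, f 0 x ∈ cyc M (c - (0 : ℕ))) ∧ ∃ e, f 0 e ∉ bd M (c - (0 : ℕ)) := by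
  obtain ⟨z, hz, hzb, hpz⟩ := exists_class_of_localize hw hwb hpw
  exact exists_chainMap_resolution hap hP hN
    (fun j hj z hz => exists_smul_mem_bd_of_exact_localize (hc j hj) hz) hz hzb hpz

theorem isBoundedAbove_iff (M : CochainComplex (ModuleCat.{u} R) ℤ) :
    IsBoundedAbove M ↔ ∃ N : ℤ, ∀ j < N, cyc M j ≤ bd M j := by
  constructor
  · rintro ⟨N, hN⟩
    exact ⟨-N, fun j hj => (subsingleton_homologyModule_iff M (-j) j (by omega)).1
      (hN _ (by omega))⟩
  · rintro ⟨N, hN⟩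
    exact ⟨-N, fun j hj => (subsingleton_homologyModule_iff M j (-j) (by omega)).2
      (hN _ (by omega))⟩

theorem isBoundedBelow_iff (M : CochainComplex (ModuleCat.{u} R) ℤ) :
    IsBoundedBelow M ↔ ∃ N : ℤ, ∀ j, N < j → cyc M j ≤ bd M j := by
  constructor
  · rintro ⟨N, hN⟩
    exact ⟨-N, fun j hj => (subsingleton_homologyModule_iff M (-j) j (by omega)).1
      (hN _ (by omega))⟩
  · rintro ⟨N, hN⟩
    exact ⟨-N, fun j hj => (subsingleton_homologyModule_iff M j (-j) (by omega)).2
      (hN _ (by omega))⟩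

theorem isBoundedAbove_localize (h : IsBoundedAbove M) : IsBoundedAbove (localize p M) := by
  obtain ⟨N, hN⟩ := (isBoundedAbove_iff M).1 h
  exact (isBoundedAbove_iff _).2 ⟨N, fun j hj => exact_localize (hN j hj)⟩

theorem exact_of_isTrivialComplex (h : IsTrivialComplex M) (j : ℤ) : cyc M j ≤ bd M j :=
  (subsingleton_homologyModule_iff M (-j) j (by omega)).1 (h _)

theorem smul_residueField_eq_zero {A : Type u} [CommRing A] [IsLocalRing A] :
    ∀ r ∈ IsLocalRing.maximalIdeal A, ∀ x : IsLocalRing.ResidueField A, r • x = 0 := by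
  intro r hr x
  obtain ⟨y, rfl⟩ := IsLocalRing.residue_surjective x
  change IsLocalRing.residue _ (r * y) = 0
  exact (IsLocalRing.residue_eq_zero_iff _).2 (Ideal.mul_mem_right _ _ hr)

theorem not_isTrivialComplex_derivedHom [IsNoetherianRing R] {a : Ideal R} (hap : a ≤ p.asIdeal)
    (hM : IsBoundedAbove M) (hp : p ∈ Ass M) :
    ¬ IsTrivialComplex (derivedHom (ModuleCat.of R (R ⧸ a)) M) := by
  intro h0
  obtain ⟨hdepth, hlt⟩ := hp
  have hne : (homologyDegrees (localize p M)).Nonempty := by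
    rw [Set.nonempty_iff_ne_empty]
    intro he
    simp [supH, he] at hlt
  obtain ⟨s, -, hmax, hs⟩ := exists_max_homologyDegrees (isBoundedAbove_localize hM) hne
  -- The depth equality now says that `RHom(k(p), M_p)` has supremum `s`, so its homology in degree
  -- `s` is nonzero.
  rw [depth, hs, neg_inj] at hdepth
  have h1 := mem_of_supH_eq hdepth
  rw [mem_homologyDegrees_iff _ s (-s) (by omega)] at h1
  have hex : ∀ j < -s, cyc (localize p M) j ≤ bd (localize p M) j := fun j hj => by
    by_contra hj'
    have := hmax _ ((mem_homologyDegrees_iff _ (-j) j (by omega)).2 hj')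
    omega
  obtain ⟨π, hπ⟩ := exists_isResolution_projRes
    (ModuleCat.of (Localization.AtPrime p.asIdeal)
      (IsLocalRing.ResidueField (Localization.AtPrime p.asIdeal)))
  obtain ⟨w, hw, hwb, hpw⟩ := exists_class_of_homComplex hπ hex h1
  obtain ⟨ρ, hρ⟩ := exists_isResolution_projRes (ModuleCat.of R (R ⧸ a))
  obtain ⟨N, hN⟩ := (isBoundedAbove_iff M).1 hM
  obtain ⟨f, hf, hfc, e, he⟩ := exists_chainMap_of_localize hap hρ hN hex hw hwb
    (fun r hr => hpw r (smul_residueField_eq_zero r hr))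
  exact not_exact_homComplex hρ.subsingleton f hf hfc e he (exact_of_isTrivialComplex h0 (-s))

end Localize

/-! ### Injective modules: extension, direct sums, cogeneration -/

section InjectiveModules

variable {R : Type u} [CommRing R]

/-- Passing to the quotient by `ker f` makes `f` injective. In this form `f` may be a differential.
-/
theorem exists_extension {E X Y : Type u} [AddCommGroup E] [Module R E] [AddCommGroup X]
    [Module R X] [AddCommGroup Y] [Module R Y] (hE : Module.Injective R E) (f : X →ₗ[R] Y)
    (g : X →ₗ[R] E) (h : LinearMap.ker f ≤ LinearMap.ker g) :
    ∃ l : Y →ₗ[R] E, ∀ x, l (f x) = g x := by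
  obtain ⟨l, hl⟩ := hE.out ((LinearMap.ker f).liftQ f le_rfl)
    (LinearMap.ker_eq_bot.1 (Submodule.ker_liftQ_eq_bot' _ f rfl)) ((LinearMap.ker f).liftQ g h)
  exact ⟨l, fun x => hl (Submodule.Quotient.mk x)⟩

theorem injective_directSum [IsNoetherianRing R] {ι : Type u} (E : ι → Type u)
    [∀ i, AddCommGroup (E i)] [∀ i, Module R (E i)] (hE : ∀ i, Module.Injective R (E i)) :
    Module.Injective R (⨁ i, E i) := by
  classical
  apply Module.Baer.injective
  intro I g
  obtain ⟨G, hG⟩ := IsNoetherian.noetherian (⊤ : Submodule R I)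
  -- In Baer's criterion the ideal is finitely generated, so `g` meets only the finitely many
  -- summands supporting the images of generators; each component is extended separately.
  let s : Finset ι := G.biUnion fun x => DFinsupp.support (g x)
  have hs : ∀ i ∉ s, DirectSum.component R ι E i ∘ₗ g = 0 := by
    intro i hi
    rw [← LinearMap.ker_eq_top, eq_top_iff, ← hG, Submodule.span_le]
    intro x hx
    by_contra h
    exact hi (Finset.mem_biUnion.2 ⟨x, hx, DFinsupp.mem_support_iff.2 h⟩)
  choose h hh using fun i => exists_extension (hE i) I.subtype (DirectSum.component R ι E i ∘ₗ g)
    (by simp)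
  refine ⟨∑ i ∈ s, DirectSum.lof R ι E i ∘ₗ h i, fun x hx => ?_⟩
  refine DirectSum.ext_component R fun j => ?_
  have hh' (i) : h i x = DirectSum.component R ι E i (g ⟨x, hx⟩) := hh i ⟨x, hx⟩
  simp only [LinearMap.coe_sum, Finset.sum_apply, LinearMap.comp_apply, hh', map_sum]
  rw [Finset.sum_eq_single j]
  · exact DirectSum.component.lof_self R j _
  · intro i _ hij
    exact (DirectSum.component.of R _ _ _).trans (dif_neg hij)
  · intro hj
    have := LinearMap.congr_fun (hs j hj) ⟨x, hx⟩
    rw [LinearMap.comp_apply] at this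
    rw [this]; simp

theorem injective_injectiveHull (K : Type u) [AddCommGroup K] [Module R K] :
    Module.Injective R (injectiveHull R K) :=
  (injectiveHull_spec R K).choose_spec.injective_module

/-- The annihilator of `y ≠ 0` is a proper ideal, so `y ↦ 1` defines a map from `R y` to the residue
field, which extends to `Y` by injectivity. -/
theorem exists_map_injectiveHull_ne_zero [IsLocalRing R] {Y : Type u} [AddCommGroup Y] [Module R Y]
    {y : Y} (hy : y ≠ 0) :
    ∃ g : Y →ₗ[R] injectiveHull R (IsLocalRing.ResidueField R), g y ≠ 0 := by
  obtain ⟨ι, hι⟩ := injectiveHull_spec R (IsLocalRing.ResidueField R)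
  obtain ⟨g, hg⟩ := exists_extension hι.injective_module (LinearMap.toSpanSingleton R Y y)
    (ι ∘ₗ Algebra.linearMap R (IsLocalRing.ResidueField R)) (by
      intro a ha
      have ha' : a • y = 0 := ha
      have h1 : a ∈ IsLocalRing.maximalIdeal R := by
        by_contra h
        rw [IsLocalRing.mem_maximalIdeal, mem_nonunits_iff, not_not] at h
        exact hy (h.smul_eq_zero.1 ha')
      change ι (IsLocalRing.residue R a) = 0
      rw [(IsLocalRing.residue_eq_zero_iff a).2 h1, map_zero])
  refine ⟨g, fun h0 => ?_⟩
  have h1 := hg 1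
  rw [LinearMap.toSpanSingleton_apply, one_smul, h0] at h1
  have h2 : ι 1 = 0 := by simpa using h1.symm
  exact one_ne_zero (hι.injective_map (h2.trans (map_zero ι).symm))

end InjectiveModules

/-! ### Duality between the cohomology of `M` and of `Hom(M, E)` -/

section HomInto

open CochainComplex.HomComplex

variable {R : Type u} [CommRing R] {M : CochainComplex (ModuleCat.{u} R) ℤ} {E : ModuleCat.{u} R}

variable (M E) in
/-- The terms of `Hom(M, E)` are the modules of linear maps `M^{-q} → E`. -/
theorem exists_homIntoEquiv :
    ∃ e : ∀ q, (homInto M E).X q ≃ₗ[R] (M.X (-q) →ₗ[R] E),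
      ∀ (q q' : ℤ), q + 1 = q' → ∀ φ x,
        e q' (((homInto M E).d q q').hom φ) x =
          q'.negOnePow • e q φ ((M.d (-q') (-q)).hom x) := by
  let e : ∀ q, (homInto M E).X q ≃ₗ[R] (M.X (-q) →ₗ[R] E) := fun q =>
    { toFun := fun α => (Cochain.toSingleEquiv (K := M) (X := E) (neg_add_cancel q) α).hom
      invFun := fun f => Cochain.toSingleMk (K := M) (X := E) (ModuleCat.ofHom f) (neg_add_cancel q)
      map_add' := fun α β => congrArg ModuleCat.Hom.hom
        ((Cochain.toSingleEquiv (K := M) (X := E) (neg_add_cancel q)).map_add α β)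
      map_smul' := fun r α => rfl
      left_inv := fun α => (Cochain.toSingleEquiv (K := M) (X := E) (neg_add_cancel q)).left_inv α
      right_inv := fun f => congrArg ModuleCat.Hom.hom
        ((Cochain.toSingleEquiv (K := M) (X := E) (neg_add_cancel q)).right_inv (ModuleCat.ofHom f)) }
  refine ⟨e, fun q q' h φ x => ?_⟩
  obtain ⟨f, rfl⟩ := (e q).symm.surjective φ
  rw [LinearEquiv.apply_symm_apply]
  have h1 : ((homInto M E).d q q').hom ((e q).symm f) =
      (q'.negOnePow • (e q').symm (f ∘ₗ (M.d (-q') (-q)).hom)) :=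
    Cochain.δ_toSingleMk (K := M) (X := E) (ModuleCat.ofHom f) (neg_add_cancel q) q' (-q')
      (neg_add_cancel q')
  rw [h1, ← LinearEquiv.coe_coe, LinearMap.map_smul_of_tower, LinearEquiv.coe_coe,
    LinearEquiv.apply_symm_apply]
  rfl

theorem mem_cyc_homInto_iff {e : ∀ q, (homInto M E).X q ≃ₗ[R] (M.X (-q) →ₗ[R] E)}
    (he : ∀ (q q' : ℤ), q + 1 = q' → ∀ φ x, e q' (((homInto M E).d q q').hom φ) x =
      q'.negOnePow • e q φ ((M.d (-q') (-q)).hom x)) {q : ℤ} {φ : (homInto M E).X q} :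
    φ ∈ cyc (homInto M E) q ↔ ∀ z ∈ bd M (-q), e q φ z = 0 := by
  rw [mem_cyc rfl, ← (e (q + 1)).map_eq_zero_iff]
  constructor
  · rintro h z hz
    obtain ⟨y, rfl⟩ := (mem_bd (j := -(q + 1)) (by ring)).1 hz
    have h1 := he q _ rfl φ y
    rw [h, LinearMap.zero_apply] at h1
    exact (smul_eq_zero_iff_eq _).1 h1.symm
  · intro h
    ext x
    rw [he q _ rfl, h _ ((mem_bd (by ring)).2 ⟨x, rfl⟩), smul_zero]
    rfl

theorem apply_eq_zero_of_mem_bd_homInto {e : ∀ q, (homInto M E).X q ≃ₗ[R] (M.X (-q) →ₗ[R] E)}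
    (he : ∀ (q q' : ℤ), q + 1 = q' → ∀ φ x, e q' (((homInto M E).d q q').hom φ) x =
      q'.negOnePow • e q φ ((M.d (-q') (-q)).hom x)) {q : ℤ} {φ : (homInto M E).X q}
    (h : φ ∈ bd (homInto M E) q) {z : M.X (-q)} (hz : z ∈ cyc M (-q)) : e q φ z = 0 := by
  obtain ⟨ψ, rfl⟩ := h
  rw [he _ _ (by ring), (mem_cyc (by ring)).1 hz, map_zero, smul_zero]

/-- A functional vanishing on cycles factors through the image of the differential and extends from
there by injectivity. -/
theorem mem_bd_homInto (hE : Module.Injective R E)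
    {e : ∀ q, (homInto M E).X q ≃ₗ[R] (M.X (-q) →ₗ[R] E)}
    (he : ∀ (q q' : ℤ), q + 1 = q' → ∀ φ x, e q' (((homInto M E).d q q').hom φ) x =
      q'.negOnePow • e q φ ((M.d (-q') (-q)).hom x)) {q : ℤ} {φ : (homInto M E).X q}
    (h : ∀ z ∈ cyc M (-q), e q φ z = 0) : φ ∈ bd (homInto M E) q := by
  obtain ⟨l, hl⟩ := exists_extension hE (M.d (-q) (-(q - 1))).hom (e q φ)
    (fun z hz => h z ((mem_cyc (by ring)).2 hz))
  refine ⟨(e (q - 1)).symm (q.negOnePow • l), (e q).injective (LinearMap.ext fun x => ?_)⟩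
  rw [he _ _ (by ring), LinearEquiv.apply_symm_apply, LinearMap.smul_apply, smul_smul,
    Int.units_mul_self, one_smul, hl]

theorem exact_homInto (hE : Module.Injective R E) {q : ℤ} (h : cyc M (-q) ≤ bd M (-q)) :
    cyc (homInto M E) q ≤ bd (homInto M E) q := by
  obtain ⟨e, he⟩ := exists_homIntoEquiv M E
  exact fun φ hφ => mem_bd_homInto hE he fun z hz => (mem_cyc_homInto_iff he).1 hφ z (h hz)

theorem exact_of_homInto
    (hE : ∀ (Y : Type u) [AddCommGroup Y] [Module R Y] (y : Y), y ≠ 0 → ∃ g : Y →ₗ[R] E, g y ≠ 0)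
    {q : ℤ} (h : cyc (homInto M E) q ≤ bd (homInto M E) q) : cyc M (-q) ≤ bd M (-q) := by
  obtain ⟨e, he⟩ := exists_homIntoEquiv M E
  intro z hz
  by_contra hzb
  obtain ⟨g, hg⟩ := hE (M.X (-q) ⧸ bd M (-q)) (Submodule.Quotient.mk z)
    (fun h => hzb ((Submodule.Quotient.mk_eq_zero _).1 h))
  apply hg
  have h1 : (e q).symm (g ∘ₗ (bd M (-q)).mkQ) ∈ cyc (homInto M E) q := by
    refine (mem_cyc_homInto_iff he).2 fun y hy => ?_
    rw [LinearEquiv.apply_symm_apply, LinearMap.comp_apply, Submodule.mkQ_apply,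
      (Submodule.Quotient.mk_eq_zero _).2 hy, map_zero]
  have h2 := apply_eq_zero_of_mem_bd_homInto he (h h1) hz
  rwa [LinearEquiv.apply_symm_apply] at h2

/-- If the cohomology `H` of `Hom(M, E)` satisfies `H ≠ m H`, then the corresponding cohomology
module of `M` has a nonzero element killed by `m`. -/
theorem exists_class_of_homInto (hE : Module.Injective R E) {m : Ideal R} (hm : m.FG) {q : ℤ}
    (h : ¬ cyc (homInto M E) q ≤ m • cyc (homInto M E) q ⊔ bd (homInto M E) q) :
    ∃ z ∈ cyc M (-q), z ∉ bd M (-q) ∧ ∀ r ∈ m, r • z ∈ bd M (-q) := by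
  obtain ⟨e, he⟩ := exists_homIntoEquiv M E
  by_contra! hcon
  apply h
  intro φ hφ
  obtain ⟨G, rfl⟩ := hm
  let B := bd M (-q)
  have hcon' : ∀ z ∈ cyc M (-q), (∀ r : G, r.1 • z ∈ B) → z ∈ B := by
    intro z hz hr
    by_contra hzb
    obtain ⟨r, hr1, hr2⟩ := hcon z hz hzb
    apply hr2
    have : Submodule.span R (G : Set R) ≤ B.comap (LinearMap.toSpanSingleton R _ z) :=
      Submodule.span_le.2 fun r hrG => hr ⟨r, hrG⟩
    exact this hr1
  -- If no nonzero class is killed by `m`, the kernel of `μ : z ↦ (r z mod B)_r` consists of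
  -- boundaries, which `φ` kills. So `φ` factors through `μ` by some `H`, whose components `ψ r`
  -- give `φ = ∑ r • ψ r` on cycles.
  let μ : cyc M (-q) →ₗ[R] (G → (M.X (-q) ⧸ B)) :=
    LinearMap.pi fun r => r.1 • (B.mkQ ∘ₗ (cyc M (-q)).subtype)
  obtain ⟨H, hH⟩ := exists_extension hE μ (e q φ ∘ₗ (cyc M (-q)).subtype) (by
    intro z hz
    refine (mem_cyc_homInto_iff he).1 hφ _ (hcon' z z.2 fun r => ?_)
    exact (Submodule.Quotient.mk_eq_zero _).1 (congrFun (LinearMap.mem_ker.1 hz) r))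
  classical
  let ψ : G → (homInto M E).X q := fun r =>
    (e q).symm (H ∘ₗ LinearMap.single R (fun _ : G => M.X (-q) ⧸ B) r ∘ₗ B.mkQ)
  have hψ (r) : ψ r ∈ cyc (homInto M E) q := by
    refine (mem_cyc_homInto_iff he).2 fun y hy => ?_
    rw [LinearEquiv.apply_symm_apply, LinearMap.comp_apply, LinearMap.comp_apply,
      Submodule.mkQ_apply, (Submodule.Quotient.mk_eq_zero _).2 hy, map_zero, map_zero]
  have hsum : ∑ r : G, r.1 • ψ r ∈ Submodule.span R (G : Set R) • cyc (homInto M E) q :=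
    Submodule.sum_mem _ fun r _ => Submodule.smul_mem_smul (Submodule.subset_span r.2) (hψ r)
  rw [← add_sub_cancel (∑ r : G, r.1 • ψ r) φ]
  refine Submodule.add_mem_sup hsum (mem_bd_homInto hE he fun z hz => ?_)
  rw [map_sub, LinearMap.sub_apply, sub_eq_zero]
  refine (hH ⟨z, hz⟩).symm.trans ?_
  rw [← Finset.univ_sum_single (μ ⟨z, hz⟩), map_sum, map_sum, LinearMap.sum_apply]
  refine Finset.sum_congr rfl fun r _ => ?_
  rw [map_smul, LinearEquiv.apply_symm_apply]
  change H (Pi.single r (r.1 • B.mkQ z)) = r.1 • H (Pi.single r (B.mkQ z))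
  rw [Pi.single_smul, map_smul]

end HomInto

/-! ### Cohomology of `P ⊗ C` in the critical degree -/

section Tensor

open scoped TensorProduct

variable {R : Type u} [CommRing R]

/-- The inclusion of a summand of the total tensor product of two complexes. -/
noncomputable def tensorι (P C : CochainComplex (ModuleCat.{u} R) ℤ) (i j n : ℤ) (h : i + j = n) :
    P.X i ⊗[R] C.X j →ₗ[R] (HomologicalComplex.tensorObj P C).X n :=
  (HomologicalComplex.ιTensorObj P C i j n h).hom

variable {P C : CochainComplex (ModuleCat.{u} R) ℤ}

theorem exists_tensor_desc {n : ℤ} {A : Type u} [AddCommGroup A] [Module R A]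
    (g : ∀ i j : ℤ, i + j = n → P.X i ⊗[R] C.X j →ₗ[R] A) :
    ∃ θ : (HomologicalComplex.tensorObj P C).X n →ₗ[R] A,
      ∀ i j h t, θ (tensorι P C i j n h t) = g i j h t := by
  let G : ∀ (i j : ℤ), i + j = n →
      (((MonoidalCategory.curriedTensor (ModuleCat.{u} R)).obj (P.X i)).obj (C.X j) ⟶
        ModuleCat.of R A) := fun i j h => ModuleCat.ofHom (g i j h)
  have key := HomologicalComplex.ι_mapBifunctorDesc (K₁ := P) (K₂ := C) (c := ComplexShape.up ℤ)
    (F := MonoidalCategory.curriedTensor (ModuleCat.{u} R)) G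
  refine ⟨(HomologicalComplex.mapBifunctorDesc (K₁ := P) (K₂ := C) (c := ComplexShape.up ℤ)
    (F := MonoidalCategory.curriedTensor (ModuleCat.{u} R)) G).hom, fun i j h t => ?_⟩
  exact LinearMap.congr_fun (congrArg ModuleCat.Hom.hom (key i j h)) t

theorem tensor_hom_ext {n : ℤ} {A : Type u} [AddCommGroup A] [Module R A]
    {f g : (HomologicalComplex.tensorObj P C).X n →ₗ[R] A}
    (h : ∀ i j h t, f (tensorι P C i j n h t) = g (tensorι P C i j n h t)) : f = g := by
  have : ModuleCat.ofHom f = ModuleCat.ofHom g := by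
    apply HomologicalComplex.mapBifunctor.hom_ext
    intro i j hij
    apply ModuleCat.hom_ext
    exact LinearMap.ext fun t => h i j hij t
  exact congrArg ModuleCat.Hom.hom this

theorem tensor_d_apply {i j n i' j' n' : ℤ} (h : i + j = n) (hn : n + 1 = n') (hi : i + 1 = i')
    (hj : j + 1 = j') (t : P.X i ⊗[R] C.X j) :
    ((HomologicalComplex.tensorObj P C).d n n').hom (tensorι P C i j n h t) =
      tensorι P C i' j n' (by omega) ((P.d i i').hom.rTensor (C.X j) t) +
      i.negOnePow • tensorι P C i j' n' (by omega) ((C.d j j').hom.lTensor (P.X i) t) := by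
  have key : HomologicalComplex.ιTensorObj P C i j n h ≫ (HomologicalComplex.tensorObj P C).d n n' =
      ModuleCat.ofHom ((P.d i i').hom.rTensor (C.X j)) ≫
        HomologicalComplex.ιTensorObj P C i' j n' (by omega) +
      i.negOnePow • ModuleCat.ofHom ((C.d j j').hom.lTensor (P.X i)) ≫
        HomologicalComplex.ιTensorObj P C i j' n' (by omega) := by
    rw [HomologicalComplex.mapBifunctor.d_eq, Preadditive.comp_add,
      HomologicalComplex.mapBifunctor.ι_D₁, HomologicalComplex.mapBifunctor.ι_D₂,
      HomologicalComplex.mapBifunctor.d₁_eq _ _ _ _ (show (ComplexShape.up ℤ).Rel i i' from hi) _ _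
        (show i' + j = n' by omega),
      HomologicalComplex.mapBifunctor.d₂_eq _ _ _ _ _ (show (ComplexShape.up ℤ).Rel j j' from hj) _
        (show i + j' = n' by omega)]
    have h1 : ComplexShape.ε₁ (.up ℤ) (.up ℤ) (.up ℤ) (i, j) = 1 := rfl
    have h2 : ComplexShape.ε₂ (.up ℤ) (.up ℤ) (.up ℤ) (i, j) = i.negOnePow := rfl
    rw [h1, h2, one_smul]
    rfl
  exact LinearMap.congr_fun (congrArg ModuleCat.Hom.hom key) t

theorem exists_tensor_proj {i j n : ℤ} (h : i + j = n) :
    ∃ q : (HomologicalComplex.tensorObj P C).X n →ₗ[R] P.X i ⊗[R] C.X j,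
      (∀ t, q (tensorι P C i j n h t) = t) ∧
      ∀ i' j' h' t, i' ≠ i → q (tensorι P C i' j' n h' t) = 0 := by
  have aux : ∀ i' j' : ℤ, i' + j' = n → ∃ g : P.X i' ⊗[R] C.X j' →ₗ[R] P.X i ⊗[R] C.X j,
      (i' ≠ i → g = 0) ∧ ∀ (hi : i = i') (hj : j = j'),
        g ∘ₗ TensorProduct.map (P.XIsoOfEq hi).hom.hom (C.XIsoOfEq hj).hom.hom = .id := by
    intro i' j' h'
    by_cases hi : i' = i
    · subst hi
      obtain rfl : j' = j := by omega
      exact ⟨.id, fun h => absurd rfl h, fun _ _ => by simp⟩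
    · exact ⟨0, fun _ => rfl, fun h => absurd h.symm hi⟩
  choose g hg0 hg using aux
  obtain ⟨q, hq⟩ := exists_tensor_desc g
  refine ⟨q, fun t => ?_, fun i' j' h' t hi => by rw [hq, hg0 _ _ _ hi]; rfl⟩
  rw [hq]
  simpa using LinearMap.congr_fun (hg i j h rfl rfl) t

/-- If `r` kills `X`, then `r • x = d y`, so `x ⊗ r z = d (y ⊗ z)` for a cycle `z`. If `z = d y`,
then `x ⊗ z = d (x ⊗ y)`, because `P` vanishes in degree `1`. -/
theorem tensorι_mem_bd {X : ModuleCat.{u} R} {π : P.X 0 →ₗ[R] X} (hP : IsResolution P X π)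
    {m : Ideal R} (hm : ∀ r ∈ m, ∀ x : X, r • x = 0) {n : ℤ}
    (hn : cyc C n ≤ m • cyc C n ⊔ bd C n) (x : P.X 0) {z : C.X n} (hz : z ∈ cyc C n) :
    tensorι P C 0 n n (zero_add n) (x ⊗ₜ z) ∈ bd (HomologicalComplex.tensorObj P C) n := by
  let ψ : C.X n →ₗ[R] (HomologicalComplex.tensorObj P C).X n :=
    tensorι P C 0 n n (zero_add n) ∘ₗ TensorProduct.mk R _ _ x
  suffices m • cyc C n ⊔ bd C n ≤ (bd (HomologicalComplex.tensorObj P C) n).comap ψ from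
    this (hn hz)
  refine sup_le (Submodule.smul_le.2 fun r hr z hz => ?_) ?_
  · have hx : r • x ∈ bd P 0 := by
      rw [← hP.ker, LinearMap.mem_ker, map_smul, hm r hr]
    obtain ⟨y, hy⟩ := (mem_bd (j := -1) (by norm_num)).1 hx
    refine (mem_bd (j := n - 1) (by ring)).2 ⟨tensorι P C (-1) n (n - 1) (by ring) (y ⊗ₜ z), ?_⟩
    rw [tensor_d_apply (i' := 0) (j' := n + 1) _ (by ring) (by ring) rfl, LinearMap.rTensor_tmul,
      LinearMap.lTensor_tmul, hy, (mem_cyc rfl).1 hz, TensorProduct.tmul_zero, map_zero, smul_zero,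
      add_zero]
    change _ = tensorι P C 0 n n _ (x ⊗ₜ (r • z))
    rw [TensorProduct.smul_tmul]
  · rintro _ ⟨y, rfl⟩
    have := hP.subsingleton 1 one_pos
    refine (mem_bd (j := n - 1) (by ring)).2
      ⟨tensorι P C 0 (n - 1) (n - 1) (zero_add _) (x ⊗ₜ y), ?_⟩
    rw [tensor_d_apply (i' := 1) (j' := n) _ (by ring) (by ring) (by ring), LinearMap.rTensor_tmul,
      LinearMap.lTensor_tmul, Subsingleton.elim ((P.d 0 1).hom x) 0, TensorProduct.zero_tmul,
      map_zero, zero_add, Int.negOnePow_zero, one_smul]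
    rfl

/-- If `C` has no cohomology above degree `n` and `H = m H` for its cohomology `H` in degree `n`,
then `P ⊗ C` has no cohomology in degree `n`, where `P` is a resolution of a module killed
by `m`. -/
theorem exact_tensor {X : ModuleCat.{u} R} {π : P.X 0 →ₗ[R] X} (hP : IsResolution P X π)
    {m : Ideal R} (hm : ∀ r ∈ m, ∀ x : X, r • x = 0) {n : ℤ}
    (hC : ∀ j, n < j → cyc C j ≤ bd C j) (hn : cyc C n ≤ m • cyc C n ⊔ bd C n) :
    cyc (HomologicalComplex.tensorObj P C) n ≤ bd (HomologicalComplex.tensorObj P C) n := by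
  let T := HomologicalComplex.tensorObj P C
  -- The filtration by degree in `P`: it is zero from degree `1` up, and every element lies in some
  -- `F (1 - a)`.
  let F : ℤ → Submodule R (T.X n) := fun i =>
    Submodule.span R {w | ∃ i' j h t, i ≤ i' ∧ w = tensorι P C i' j n h t}
  have hmem {i i' j : ℤ} (h : i' + j = n) (hi : i ≤ i') (t) : tensorι P C i' j n h t ∈ F i :=
    Submodule.subset_span ⟨i', j, h, t, hi, rfl⟩
  have hmono {i i' : ℤ} (h : i' ≤ i) : F i ≤ F i' := Submodule.span_mono <| by
    rintro w ⟨i₁, j, hij, t, hi, rfl⟩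
    exact ⟨i₁, j, hij, t, h.trans hi, rfl⟩
  have hstep (i j : ℤ) (h : i + j = n) {w} (hw : w ∈ F i) :
      ∃ w' ∈ F (i + 1), ∃ t, w = w' + tensorι P C i j n h t := by
    have hle : F i ≤ F (i + 1) ⊔ LinearMap.range (tensorι P C i j n h) := by
      refine Submodule.span_le.2 ?_
      rintro _ ⟨i', j', h', t, hi, rfl⟩
      by_cases hii : i' = i
      · subst hii
        obtain rfl : j = j' := by omega
        exact Submodule.mem_sup_right ⟨t, rfl⟩
      · exact Submodule.mem_sup_left (hmem h' (by omega) t)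
    obtain ⟨w', hw', _, ⟨t, rfl⟩, rfl⟩ := Submodule.mem_sup.1 (hle hw)
    exact ⟨w', hw', t, rfl⟩
  -- the bottom component of a cycle is a cycle for the differential of `C`
  have hbot (i j : ℤ) (h : i + j = n) {w'} (hw' : w' ∈ F (i + 1)) (t)
      (hc : w' + tensorι P C i j n h t ∈ cyc T n) :
      (C.d j (j + 1)).hom.lTensor (P.X i) t = 0 := by
    obtain ⟨q, hq, hq0⟩ := exists_tensor_proj (P := P) (C := C) (i := i) (j := j + 1) (n := n + 1)
      (by omega)
    have h1 : q ((T.d n (n + 1)).hom w') = 0 := by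
      suffices F (i + 1) ≤ LinearMap.ker (q ∘ₗ (T.d n (n + 1)).hom) from this hw'
      refine Submodule.span_le.2 ?_
      rintro _ ⟨i', j', h', t, hi, rfl⟩
      change q ((T.d n (n + 1)).hom _) = 0
      rw [tensor_d_apply h' rfl rfl rfl, map_add, LinearMap.map_smul_of_tower,
        hq0 _ _ _ _ (by omega), hq0 _ _ _ _ (by omega), smul_zero, add_zero]
    have h2 := congrArg q ((mem_cyc rfl).1 hc)
    rw [map_add, map_add, h1, zero_add, tensor_d_apply h rfl rfl rfl, map_add,
      LinearMap.map_smul_of_tower, hq0 _ _ _ _ (by omega), zero_add, hq, map_zero] at h2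
    exact (smul_eq_zero_iff_eq _).1 h2
  -- Modulo boundaries the bottom component moves one step up. For `i < 0`, exactness of `C` above
  -- `n` and flatness of `P.X i` write it as the image of some `s`; for `i = 0`, `H = mH` makes it a
  -- boundary.
  have hcase (i j : ℤ) (h : i + j = n) (hi : i ≤ 0) (t)
      (ht : (C.d j (j + 1)).hom.lTensor (P.X i) t = 0) :
      ∃ v ∈ F (i + 1), v + tensorι P C i j n h t ∈ bd T n := by
    have := hP.projective i
    rcases hi.lt_or_eq with hi | rfl
    · have hCj : Function.Exact (C.d (j - 1) j).hom (C.d j (j + 1)).hom := fun z =>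
        ⟨fun hz => hC j (by omega) hz, fun hz => bd_le_cyc C j hz⟩
      obtain ⟨s, rfl⟩ := (Module.Flat.lTensor_exact (P.X i) hCj t).1 ht
      refine ⟨i.negOnePow • tensorι P C (i + 1) (j - 1) n (by omega)
        ((P.d i (i + 1)).hom.rTensor (C.X (j - 1)) s), ?_, ?_⟩
      · rw [Units.smul_def]
        exact zsmul_mem (hmem (i := i + 1) (i' := i + 1) _ le_rfl _) _
      · refine (mem_bd (j := n - 1) (by ring)).2
          ⟨i.negOnePow • tensorι P C i (j - 1) (n - 1) (by omega) s, ?_⟩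
        rw [LinearMap.map_smul_of_tower, tensor_d_apply (i' := i + 1) (j' := j) _ (by ring) rfl
          (by ring), smul_add, smul_smul, Int.units_mul_self, one_smul]
    · obtain rfl : j = n := by omega
      refine ⟨0, Submodule.zero_mem _, ?_⟩
      obtain ⟨s, hs⟩ : ∃ s, (cyc C j).subtype.lTensor (P.X 0) s = t :=
        (Module.Flat.lTensor_exact (P.X 0)
          (LinearMap.exact_subtype_ker_map (C.d j (j + 1)).hom) t).1 ht
      rw [zero_add, ← hs]
      clear hs ht t
      induction s with
      | zero => rw [map_zero, map_zero]; exact Submodule.zero_mem _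
      | tmul x z => exact tensorι_mem_bd hP hm hn x z.2
      | add s₁ s₂ h₁ h₂ => rw [map_add, map_add]; exact Submodule.add_mem _ h₁ h₂
  have claim : ∀ (a : ℕ) (w : T.X n), w ∈ F (1 - a) → w ∈ cyc T n → w ∈ bd T n := by
    intro a
    induction a with
    | zero =>
      intro w hw _
      have : F (1 - (0 : ℕ)) ≤ ⊥ := Submodule.span_le.2 <| by
        rintro _ ⟨i, j, h, t, hi, rfl⟩
        have := hP.subsingleton i (by simp at hi; omega)
        have ht : t = 0 := by
          induction t with
          | zero => rfl
          | tmul x y => rw [Subsingleton.elim x 0, TensorProduct.zero_tmul]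
          | add s₁ s₂ h₁ h₂ => rw [h₁, h₂, add_zero]
        rw [ht, map_zero]
        exact Submodule.zero_mem _
      rw [(Submodule.mem_bot R).1 (this hw)]
      exact Submodule.zero_mem _
    | succ a ih =>
      intro w hw hwc
      obtain ⟨w', hw', t, rfl⟩ := hstep _ (n - (1 - (a + 1 : ℕ))) (by ring) hw
      have ht := hbot _ _ _ hw' t hwc
      obtain ⟨v, hv, hvt⟩ := hcase _ _ (by ring) (by push_cast; omega) t ht
      have hsub : 1 - ((a + 1 : ℕ) : ℤ) + 1 = 1 - a := by push_cast; ring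
      rw [hsub] at hw' hv
      have h1 : w' - v ∈ bd T n := by
        refine ih _ (Submodule.sub_mem _ hw' hv) ?_
        have := Submodule.sub_mem _ hwc (bd_le_cyc _ _ hvt)
        rwa [add_sub_add_right_eq_sub] at this
      have := Submodule.add_mem _ h1 hvt
      rwa [← add_assoc, sub_add_cancel] at this
  intro w hw
  obtain ⟨a, ha⟩ : ∃ a : ℕ, w ∈ F (1 - a) := by
    let G : Submodule R (T.X n) :=
      Submodule.span R {w | ∃ i j h t, w = tensorι P C i j n h t}
    have hG : w ∈ G := by
      have h0 : G.mkQ = 0 := tensor_hom_ext fun i j h t =>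
        (Submodule.Quotient.mk_eq_zero G).2 (Submodule.subset_span ⟨i, j, h, t, rfl⟩)
      exact (Submodule.Quotient.mk_eq_zero G).1 (LinearMap.congr_fun h0 w)
    clear hw
    induction hG using Submodule.span_induction with
    | mem w hw =>
      obtain ⟨i, j, h, t, rfl⟩ := hw
      exact ⟨(1 - i).toNat, hmem h (by omega) t⟩
    | zero => exact ⟨0, Submodule.zero_mem _⟩
    | add w₁ w₂ _ _ h₁ h₂ =>
      obtain ⟨a₁, h₁⟩ := h₁
      obtain ⟨a₂, h₂⟩ := h₂
      exact ⟨a₁ + a₂, Submodule.add_mem _ (hmono (by push_cast; omega) h₁)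
        (hmono (by push_cast; omega) h₂)⟩
    | smul r w _ h =>
      obtain ⟨a, h⟩ := h
      exact ⟨a, Submodule.smul_mem _ _ h⟩
  exact claim a w ha hw

/-- A chain map from `P` to `Hom(M, E)` which is not null-homotopic gives nonzero cohomology of
`P ⊗ M`. -/
theorem not_exact_tensor {P M : CochainComplex (ModuleCat.{u} R) ℤ} {E : ModuleCat.{u} R}
    (hE : Module.Injective R E) {c : ℤ} (hP : ∀ n : ℤ, 0 < n → Subsingleton (P.X n))
    (f : ∀ j : ℕ, P.X (-j) →ₗ[R] (homInto M E).X (c - j))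
    (hf : ∀ (j : ℕ) x, ((homInto M E).d (c - (j + 1 : ℕ)) (c - j)).hom (f (j + 1) x) =
      f j ((P.d (-(j + 1 : ℕ)) (-j)).hom x))
    (h₀ : ∀ x, f 0 x ∈ cyc (homInto M E) (c - (0 : ℕ))) (x₀ : P.X (-(0 : ℕ)))
    (hx₀ : f 0 x₀ ∉ bd (homInto M E) (c - (0 : ℕ))) :
    ¬ cyc (HomologicalComplex.tensorObj P M) (-c) ≤
      bd (HomologicalComplex.tensorObj P M) (-c) := by
  intro hT
  obtain ⟨e, he⟩ := exists_homIntoEquiv M E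
  let s : ℤˣ := c.negOnePow
  -- The functional adjoint to `f`, with the factor `s ^ a` chosen so that the two terms of the
  -- tensor differential cancel.
  have aux : ∀ i j : ℤ, i + j = -c → ∃ g : P.X i ⊗[R] M.X j →ₗ[R] E,
      ∀ (a : ℕ) (hi : -(a : ℤ) = i) (hj : -(c - a) = j) x y,
        g ((P.XIsoOfEq hi).hom.hom x ⊗ₜ (M.XIsoOfEq hj).hom.hom y) =
          s ^ a • e (c - a) (f a x) y := by
    intro i j hij
    by_cases hi : 0 < i
    · exact ⟨0, fun a ha => by omega⟩
    · obtain ⟨a, rfl⟩ : ∃ a : ℕ, i = -a := ⟨i.natAbs, by omega⟩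
      obtain rfl : j = -(c - a) := by omega
      refine ⟨s ^ a • TensorProduct.lift ((e (c - a)).toLinearMap ∘ₗ f a), fun b hb _ x y => ?_⟩
      obtain rfl : b = a := by omega
      simp
  choose g hg using aux
  obtain ⟨θ, hθ⟩ := exists_tensor_desc g
  have hθ' (a : ℕ) (x y) : θ (tensorι P M (-a) (-(c - a)) (-c) (by ring) (x ⊗ₜ y)) =
      s ^ a • e (c - a) (f a x) y := by
    rw [hθ, ← hg _ _ (by ring) a rfl rfl]
    simp
  have hs0 := hP (-(0 : ℕ) + 1) (by simp)
  have hd : ∀ z ∈ bd (HomologicalComplex.tensorObj P M) (-c), θ z = 0 := by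
    suffices h : θ ∘ₗ ((HomologicalComplex.tensorObj P M).d (-c - 1) (-c)).hom = 0 by
      rintro _ ⟨w, rfl⟩
      exact LinearMap.congr_fun h w
    refine tensor_hom_ext fun i j h t => ?_
    rw [LinearMap.comp_apply, LinearMap.zero_apply]
    induction t with
    | zero => rw [map_zero, map_zero, map_zero]
    | add t₁ t₂ h₁ h₂ => rw [map_add, map_add, map_add, h₁, h₂, add_zero]
    | tmul x y =>
    by_cases hi : 0 < i
    · have := hP i hi
      rw [Subsingleton.elim x 0, TensorProduct.zero_tmul, map_zero, map_zero, map_zero]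
    obtain ⟨a, rfl⟩ : ∃ a : ℕ, i = -a := ⟨i.natAbs, by omega⟩
    cases a with
    | zero =>
      rw [tensor_d_apply (i' := -(0 : ℕ) + 1) (j' := -(c - (0 : ℕ))) _ (by ring) rfl
        (by push_cast at h ⊢; omega), LinearMap.rTensor_tmul, LinearMap.lTensor_tmul,
        Subsingleton.elim ((P.d _ _).hom x) 0, TensorProduct.zero_tmul, map_zero, zero_add,
        LinearMap.map_smul_of_tower, hθ',
        (mem_cyc_homInto_iff he).1 (h₀ x) _ ((mem_bd (by push_cast at h ⊢; omega)).2 ⟨y, rfl⟩),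
        smul_zero, smul_zero]
    | succ a =>
      obtain rfl : j = -(c - a) := by push_cast at h; omega
      rw [tensor_d_apply (i' := -a) (j' := -(c - (a + 1 : ℕ))) _ (by ring) (by push_cast; ring)
        (by push_cast; ring), LinearMap.rTensor_tmul, LinearMap.lTensor_tmul, map_add,
        LinearMap.map_smul_of_tower, hθ', hθ', ← hf, he _ _ (by push_cast; ring), smul_smul,
        smul_smul]
      have hsign : (-((a + 1 : ℕ) : ℤ)).negOnePow * s ^ (a + 1) =
          -(s ^ a * (c - a).negOnePow) := by
        rw [Int.negOnePow_neg, Nat.cast_succ, Int.negOnePow_succ, Int.negOnePow_sub, pow_succ,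
          neg_mul, show c.negOnePow = s from rfl, mul_comm, mul_assoc]
      rw [hsign, Units.neg_smul, add_neg_cancel]
  -- Exactness would let `θ` factor through the differential. As `x₀ ⊗ z` is a cycle whenever `z`
  -- is, `f 0 x₀` would vanish on cycles and so be a boundary.
  obtain ⟨θ', hθ'd⟩ := exists_extension hE ((HomologicalComplex.tensorObj P M).d (-c) (-c + 1)).hom
    θ (fun z hz => hd z (hT hz))
  refine hx₀ (mem_bd_homInto hE he fun z hz => ?_)
  have h1 := hθ' 0 x₀ z
  rw [← hθ'd, tensor_d_apply _ rfl rfl rfl, LinearMap.rTensor_tmul, LinearMap.lTensor_tmul,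
    Subsingleton.elim ((P.d _ _).hom x₀) 0, (mem_cyc rfl).1 hz, TensorProduct.zero_tmul,
    TensorProduct.tmul_zero, map_zero, map_zero, smul_zero, add_zero, map_zero, pow_zero,
    one_smul] at h1
  exact h1.symm

end Tensor

/-! ### The Coass case -/

section Coassociated

variable {R : Type u} [CommRing R] {p : PrimeSpectrum R} {M : CochainComplex (ModuleCat.{u} R) ℤ}

theorem injective_dualizing [IsNoetherianRing R] : Module.Injective R
    (ModuleCat.of R (⨁ m : MaximalSpectrum R, injectiveHull R (R ⧸ m.asIdeal))) :=
  injective_directSum (fun m : MaximalSpectrum R => injectiveHull R (R ⧸ m.asIdeal))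
    fun _ => injective_injectiveHull _

theorem isBoundedAbove_dual [IsNoetherianRing R] (hM : IsBoundedBelow M) :
    IsBoundedAbove (dual M) := by
  obtain ⟨N, hN⟩ := (isBoundedBelow_iff M).1 hM
  exact (isBoundedAbove_iff _).2 ⟨-N, fun j hj =>
    exact_homInto injective_dualizing (hN _ (by omega))⟩

theorem not_isTrivialComplex_derivedTensor [IsNoetherianRing R] {a : Ideal R}
    (hap : a ≤ p.asIdeal) (hM : IsBoundedBelow M) (hp : p ∈ Coass M) :
    ¬ IsTrivialComplex (derivedTensor (ModuleCat.of R (R ⧸ a)) M) := by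
  intro h0
  obtain ⟨hsupp, hwidth⟩ := hp
  let A := Localization.AtPrime p.asIdeal
  have hE : Module.Injective A (injectiveHull A p.asIdeal.ResidueField) :=
    injective_injectiveHull _
  have hD := isBoundedAbove_dual hM
  have hC : IsBoundedBelow (colocalize p M) := by
    obtain ⟨N, hN⟩ := (isBoundedAbove_iff _).1 (isBoundedAbove_localize (p := p) hD)
    exact (isBoundedBelow_iff _).2 ⟨-N, fun j hj => exact_homInto hE (hN _ (by omega))⟩
  have hne : (homologyDegrees (colocalize p M)).Nonempty := by
    by_contra hne
    refine hsupp fun n => ?_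
    by_contra hn
    exact hne ⟨n, not_subsingleton_iff_nontrivial.1 hn⟩
  obtain ⟨s, -, hmin, hs⟩ := exists_min_homologyDegrees hC hne
  rw [width, hs] at hwidth
  have h1 := mem_of_infH_eq hwidth
  rw [mem_homologyDegrees_iff _ s (-s) (by omega)] at h1
  have hex : ∀ j, -s < j → cyc (colocalize p M) j ≤ bd (colocalize p M) j := fun j hj => by
    by_contra hj'
    have := hmin _ ((mem_homologyDegrees_iff _ (-j) j (by omega)).2 hj')
    omega
  obtain ⟨π, hπ⟩ := exists_isResolution_projRes (ModuleCat.of A (IsLocalRing.ResidueField A))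
  have h2 : ¬ cyc (colocalize p M) (-s) ≤
      IsLocalRing.maximalIdeal A • cyc (colocalize p M) (-s) ⊔ bd (colocalize p M) (-s) :=
    fun h => h1 (exact_tensor hπ smul_residueField_eq_zero hex h)
  obtain ⟨w, hw, hwb, hpw⟩ := exists_class_of_homInto hE (IsNoetherian.noetherian _) h2
  -- The injective hull of the residue field detects nonzero elements, so vanishing for the
  -- colocalization passes back to `D(M)_p`.
  have hloc : ∀ j < - -s, cyc (localize p (dual M)) j ≤ bd (localize p (dual M)) j := by
    intro j hj
    have := exact_of_homInto (fun Y _ _ y hy => exists_map_injectiveHull_ne_zero hy)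
      (hex (-j) (by omega))
    rwa [neg_neg] at this
  obtain ⟨ρ, hρ⟩ := exists_isResolution_projRes (ModuleCat.of R (R ⧸ a))
  obtain ⟨N, hN⟩ := (isBoundedAbove_iff _).1 hD
  obtain ⟨f, hf, hfc, e, he⟩ := exists_chainMap_of_localize hap hρ hN hloc hw hwb hpw
  exact not_exact_tensor injective_dualizing hρ.subsingleton f hf hfc e he
    (exact_of_isTrivialComplex h0 _)

end Coassociated

end DerivedAssoc

theorem proposition6p6 {R : Type u} [CommRing R] [IsNoetherianRing R] (a : Ideal R)
    (ha : a ≤ Ring.jacobson R) (M : CochainComplex (ModuleCat.{u} R) ℤ) :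
    (DerivedAssoc.IsBoundedAbove M →
      (DerivedAssoc.Ass M ∩ DerivedAssoc.maxSpec R).Nonempty →
      ¬ DerivedAssoc.IsTrivialComplex (DerivedAssoc.derivedHom (ModuleCat.of R (R ⧸ a)) M)) ∧
    (DerivedAssoc.IsBoundedBelow M →
      (DerivedAssoc.Coass M ∩ DerivedAssoc.maxSpec R).Nonempty →
      ¬ DerivedAssoc.IsTrivialComplex
        (DerivedAssoc.derivedTensor (ModuleCat.of R (R ⧸ a)) M)) := by
  have hle : ∀ p ∈ DerivedAssoc.maxSpec R, a ≤ p.asIdeal := fun p hp =>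
    haveI : p.asIdeal.IsMaximal := hp
    ha.trans (Ring.jacobson_le_of_isMaximal _)
  constructor
  · rintro hM ⟨p, hp, hpm⟩
    exact DerivedAssoc.not_isTrivialComplex_derivedHom (hle p hpm) hM hp
  · rintro hM ⟨p, hp, hpm⟩
    exact DerivedAssoc.not_isTrivialComplex_derivedTensor (hle p hpm) hM hp
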